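/- Fix integers $n\ge 2$ and $r,s\ge 0$ with $r+s=n$ and $(r,s)\neq(1,1)$, and let $n/2<p\le\infty$. Manifolds are smooth, $n$-dimensional, Hausdorff, second countable and without boundary (not necessarily connected); a closed manifold is a compact one. For a manifold $M$ let $D_{\mathrm{EH}}(M)=W^{2,p}_{\mathrm{loc}}(\operatorname{Sgn}M)$ be the set of (continuous) metrics of signature $(r,s)$ on $M$ that are of class $W^{2,p}_{\mathrm{loc}}$, where $r$ counts the entries $-1$ and $s$ the entries $1$. Let $\mathfrak D_{\mathrm{EH}}$ be the set of all triples $(M,g;\Omega)$ with $M$ a manifold, $g\in D_{\mathrm{EH}}(M)$ and $\Omega\subset M$ open and precompact, and let $$S_{\mathrm{EH}}:\mathfrak D_{\mathrm{EH}}\to\mathbb R,\qquad S_{\mathrm{EH}}[M,g;\Omega]=\int_\Omega R[g]\,|\det g_{\mu\nu}|^{1/2}\,dx ,$$ where $R[g]$ is the scalar curvature of $g$, computed with weak derivatives. For $(M,g;\Omega)\in\mathfrak D_{\mathrm{EH}}$ and a closed manifold $M'$ let $\mathcal U(M,g;\Omega)$ be the set of symmetric $(0,2)$-tensor fields $h$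 of class $W^{2,p}$ with compact support in $\Omega$ for which $g+h$ is again a metric of signature $(r,s)$, and define $$\Phi_{(M,g;\Omega,M')}:\ \mathcal U(M,g;\Omega)\times\big(W^{2,p}(\operatorname{Sgn}M')\cup\{0\}\big)\to\mathfrak D_{\mathrm{EH}},$$ $$\Phi_{(M,g;\Omega,M')}(h,g')=\begin{cases}(M\sqcup M',(g+h)\oplus g';\Omega\sqcup M') & \text{if } g'\ne 0,\\ (M,g+h;\Omega) & \text{if } g'=0,\end{cases}$$ where both factors of the domain carry their $W^{2,p}$ topologies. Let $\tau_0$ be the final topology on $\mathfrak D_{\mathrm{EH}}$ with respect to all the maps $\Phi_{(M,g;\Omega,M')}$. **Proposition.** $S_{\mathrm{EH}}:(\mathfrak D_{\mathrm{EH}},\tau_0)\to\mathbb R$ is discontinuous, for every $n\ge 2$, every signature $(r,s)\ne(1,1)$ with $r+s=n$, and every $p>n/2$. -/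

import Mathlib

open Set MeasureTheory Topology
open scoped ENNReal Manifold ContDiff

noncomputable section

namespace TopVar

/-! ### Second order Sobolev functions on open subsets of Euclidean space -/

/-- `ℝⁿ` with its Euclidean norm, the model space of all manifolds below. -/
abbrev Euc (n : ℕ) : Type := EuclideanSpace ℝ (Fin n)

/-- The `k`-th vector of the standard basis of `ℝⁿ`. -/
def stdVec {n : ℕ} (k : Fin n) : Euc n := EuclideanSpace.single k 1

/-- `f'` is a weak partial derivative `∂ₖ f` of `f` on the open set `U`. -/
def IsWeakDeriv {n : ℕ} (U : Set (Euc n)) (k : Fin n) (f f' : Euc n → ℝ) : Prop :=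
  LocallyIntegrableOn f U ∧ LocallyIntegrableOn f' U ∧
    ∀ φ : Euc n → ℝ, ContDiff ℝ ∞ φ → HasCompactSupport φ → tsupport φ ⊆ U →
      ∫ y in U, f y * fderiv ℝ φ y (stdVec k) = - ∫ y in U, f' y * φ y

open Classical in
/-- A weak partial derivative `∂ₖ f` of `f` on `U` (almost everywhere unique), if there is one. -/
def weakDeriv {n : ℕ} (U : Set (Euc n)) (k : Fin n) (f : Euc n → ℝ) : Euc n → ℝ :=
  if h : ∃ f', IsWeakDeriv U k f f' then h.choose else 0

/-- `f ∈ Lᵖ_loc(U)`. -/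
def MemLpLoc {n : ℕ} (p : ℝ≥0∞) (U : Set (Euc n)) (f : Euc n → ℝ) : Prop :=
  ∀ K ⊆ U, IsCompact K → MemLp f p (volume.restrict K)

/-- `f ∈ W^{2,p}_loc(U)`: weak derivatives up to second order exist, and they and `f` are in
`Lᵖ_loc(U)`. -/
def MemW2pLoc {n : ℕ} (p : ℝ≥0∞) (U : Set (Euc n)) (f : Euc n → ℝ) : Prop :=
  MemLpLoc p U f ∧
    ∃ (f₁ : Fin n → Euc n → ℝ) (f₂ : Fin n → Fin n → Euc n → ℝ),
      (∀ k, IsWeakDeriv U k f (f₁ k) ∧ MemLpLoc p U (f₁ k)) ∧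
      (∀ k l, IsWeakDeriv U k (f₁ l) (f₂ k l) ∧ MemLpLoc p U (f₂ k l))

lemma IsWeakDeriv.integrable_aux {n : ℕ} {U : Set (Euc n)} {f ψ : Euc n → ℝ}
    (hf : LocallyIntegrableOn f U) (hψ : Continuous ψ) (hc : HasCompactSupport ψ)
    (hs : tsupport ψ ⊆ U) : Integrable (fun y => f y * ψ y) (volume.restrict U) := by
  have h1 : IntegrableOn (fun y => f y * ψ y) (tsupport ψ) :=
    (hf.integrableOn_compact_subset hs hc).mul_continuousOn hψ.continuousOn hc
  have h2 : Integrable (fun y => f y * ψ y) := by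
    rw [← integrableOn_iff_integrable_of_support_subset (s := tsupport ψ)]
    · exact h1
    · intro y hy
      apply subset_tsupport
      intro h0
      exact hy (by simp [h0])
  exact h2.restrict

lemma tsupport_fderiv_apply_subset {n : ℕ} (φ : Euc n → ℝ) (v : Euc n) :
    tsupport (fun y => fderiv ℝ φ y v) ⊆ tsupport φ := by
  refine (closure_mono ?_).trans (tsupport_fderiv_subset ℝ (f := φ))
  intro y hy h0
  exact hy (by simp [h0])

lemma IsWeakDeriv.add {n : ℕ} {U : Set (Euc n)} {k : Fin n} {f f' g g' : Euc n → ℝ}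
    (hf : IsWeakDeriv U k f f') (hg : IsWeakDeriv U k g g') :
    IsWeakDeriv U k (f + g) (f' + g') := by
  refine ⟨hf.1.add hg.1, hf.2.1.add hg.2.1, fun φ h1 h2 h3 => ?_⟩
  have hD : Continuous fun y => fderiv ℝ φ y (stdVec k) :=
    (h1.continuous_fderiv (by simp)).clm_apply continuous_const
  have hDs := (tsupport_fderiv_apply_subset φ (stdVec k)).trans h3
  have hDc : HasCompactSupport fun y => fderiv ℝ φ y (stdVec k) :=
    IsCompact.of_isClosed_subset h2 (isClosed_tsupport _) (tsupport_fderiv_apply_subset φ _)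
  simp only [Pi.add_apply, add_mul]
  rw [integral_add (integrable_aux hf.1 hD hDc hDs) (integrable_aux hg.1 hD hDc hDs),
    integral_add (integrable_aux hf.2.1 h1.continuous h2 h3)
      (integrable_aux hg.2.1 h1.continuous h2 h3), hf.2.2 φ h1 h2 h3, hg.2.2 φ h1 h2 h3]
  ring

lemma MemLpLoc.add {n : ℕ} {p : ℝ≥0∞} {U : Set (Euc n)} {f g : Euc n → ℝ}
    (hf : MemLpLoc p U f) (hg : MemLpLoc p U g) : MemLpLoc p U (f + g) :=
  fun K hK hc => (hf K hK hc).add (hg K hK hc)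

lemma MemW2pLoc.add {n : ℕ} {p : ℝ≥0∞} {U : Set (Euc n)} {f g : Euc n → ℝ}
    (hf : MemW2pLoc p U f) (hg : MemW2pLoc p U g) : MemW2pLoc p U (f + g) := by
  obtain ⟨hf0, f₁, f₂, hf1, hf2⟩ := hf
  obtain ⟨hg0, g₁, g₂, hg1, hg2⟩ := hg
  exact ⟨hf0.add hg0, fun k => f₁ k + g₁ k, fun k l => f₂ k l + g₂ k l,
    fun k => ⟨(hf1 k).1.add (hg1 k).1, (hf1 k).2.add (hg1 k).2⟩,
    fun k l => ⟨(hf2 k l).1.add (hg2 k l).1, (hf2 k l).2.add (hg2 k l).2⟩⟩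

/-! ### Manifolds and symmetric tensor fields of class `W^{2,p}_loc` -/

/-- Smooth `n`-dimensional manifolds: Hausdorff, second countable, without boundary, not
necessarily connected or non-empty. -/
structure Mfd (n : ℕ) : Type 1 where
  carrier : Type
  [top : TopologicalSpace carrier]
  [t2 : T2Space carrier]
  [sc : SecondCountableTopology carrier]
  [charted : ChartedSpace (Euc n) carrier]
  [smooth : IsManifold (𝓡 n) ∞ carrier]

attribute [instance] Mfd.top Mfd.t2 Mfd.sc Mfd.charted Mfd.smooth

/-- The disjoint union `M ⊔ M'`. -/
def Mfd.sum {n : ℕ} (M M' : Mfd n) : Mfd n where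
  carrier := M.carrier ⊕ M'.carrier

/-- (Rough) fields of bilinear forms on the tangent spaces of `M`. -/
abbrev FormField {n : ℕ} (M : Mfd n) : Type :=
  (x : M.carrier) → LinearMap.BilinForm ℝ (TangentSpace (𝓡 n) x)

/-- The preferred chart at `x₀`. -/
abbrev Mfd.chart {n : ℕ} (M : Mfd n) (x₀ : M.carrier) : OpenPartialHomeomorph M.carrier (Euc n) :=
  chartAt (Euc n) x₀

/-- The coordinate vector field `∂ᵢ` of the chart at `x₀`, at the point with coordinates `y`.
Mathlib identifies the tangent space at a point `x` with `ℝⁿ` through the preferred chart at `x`;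
so `∂ᵢ` is the `i`-th partial derivative of the change of coordinates from the chart at `x₀` to the
chart at `x`. -/
def coordVec {n : ℕ} (M : Mfd n) (x₀ : M.carrier) (i : Fin n) (y : Euc n) :
    TangentSpace (𝓡 n) ((M.chart x₀).symm y) :=
  fderiv ℝ (fun z => M.chart ((M.chart x₀).symm y) ((M.chart x₀).symm z)) y (stdVec i)

/-- The components `Tᵢⱼ` of a form field in the chart at `x₀`, as functions of the coordinates
(meaningful on the target of the chart). -/
def comp {n : ℕ} {M : Mfd n} (T : FormField M) (x₀ : M.carrier) (i j : Fin n) : Euc n → ℝ :=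
  fun y => T ((M.chart x₀).symm y) (coordVec M x₀ i y) (coordVec M x₀ j y)

/-- The space `W^{2,p}_loc(Sym M)` of symmetric `(0,2)`-tensor fields on `M`. It is meant for
`p > n / 2`, where each class of fields modulo null sets has exactly one continuous
representative; the elements are these representatives. -/
structure SobolevField (n : ℕ) (p : ℝ≥0∞) (M : Mfd n) : Type where
  toFun : FormField M
  symm : ∀ x v w, toFun x v w = toFun x w v
  cont : ∀ x₀ i j, ContinuousOn (comp toFun x₀ i j) (M.chart x₀).target
  mem : ∀ x₀ i j, MemW2pLoc p (M.chart x₀).target (comp toFun x₀ i j)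

/-- First derivatives `∂ₖ Tᵢⱼ` in the chart at `x₀`. -/
def comp₁ {n : ℕ} {M : Mfd n} (T : FormField M) (x₀ : M.carrier) (k i j : Fin n) : Euc n → ℝ :=
  weakDeriv (M.chart x₀).target k (comp T x₀ i j)

/-- Second derivatives `∂ₖ ∂ₗ Tᵢⱼ` in the chart at `x₀`. -/
def comp₂ {n : ℕ} {M : Mfd n} (T : FormField M) (x₀ : M.carrier) (k l i j : Fin n) : Euc n → ℝ :=
  weakDeriv (M.chart x₀).target k (comp₁ T x₀ l i j)

/-- The `W^{2,p}`-distance of two fields over a compact subset `K` of a coordinate domain. -/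
def sobolevDist {n : ℕ} (p : ℝ≥0∞) {M : Mfd n} (x₀ : M.carrier) (K : Set (Euc n))
    (T T' : FormField M) : ℝ≥0∞ :=
  ∑ i, ∑ j, (eLpNorm (comp T x₀ i j - comp T' x₀ i j) p (volume.restrict K)
    + ∑ k, eLpNorm (comp₁ T x₀ k i j - comp₁ T' x₀ k i j) p (volume.restrict K)
    + ∑ k, ∑ l, eLpNorm (comp₂ T x₀ k l i j - comp₂ T' x₀ k l i j) p (volume.restrict K))

/-- The topology of `W^{2,p}_loc(Sym M)`: it is generated by the balls of the Sobolev
pseudodistances over all compact subsets of the coordinate domains. For compact `M` it is the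
topology of the norm of `W^{2,p}(Sym M)`; on the fields with support in a fixed precompact open
`Ω` it is the topology of the norm of `W^{2,p}(Ω)`. -/
instance {n : ℕ} {p : ℝ≥0∞} {M : Mfd n} : TopologicalSpace (SobolevField n p M) :=
  TopologicalSpace.generateFrom
    {B | ∃ (x₀ : M.carrier) (K : Set (Euc n)) (T : SobolevField n p M) (ε : ℝ≥0∞),
      IsCompact K ∧ K ⊆ (M.chart x₀).target ∧ 0 < ε ∧
      B = {T' | sobolevDist p x₀ K T'.toFun T.toFun < ε}}

/-- The sum of two tensor fields. -/
def SobolevField.add {n : ℕ} {p : ℝ≥0∞} {M : Mfd n} (g h : SobolevField n p M) :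
    SobolevField n p M where
  toFun x := g.toFun x + h.toFun x
  symm x v w := by
    simp only [LinearMap.add_apply]
    rw [g.symm x v w, h.symm x v w]
  cont x₀ i j := (g.cont x₀ i j).add (h.cont x₀ i j)
  mem x₀ i j := (g.mem x₀ i j).add (h.mem x₀ i j)

/-- The field `g ⊕ g'` on `M ⊔ M'`: the tangent space of `M ⊔ M'` at a point of `M` is the tangent
space of `M`, and likewise for `M'`. -/
def sumField {n : ℕ} {M M' : Mfd n} (T : FormField M) (T' : FormField M') : FormField (M.sum M')
  | Sum.inl x => T x
  | Sum.inr x => T' x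

lemma chart_sum_inl_symm {n : ℕ} (M M' : Mfd n) (x₀ : M.carrier) (y : Euc n) :
    ((M.sum M').chart (Sum.inl x₀)).symm y = Sum.inl ((M.chart x₀).symm y) := by
  change (chartAt (Euc n) (Sum.inl x₀ : M.carrier ⊕ M'.carrier)).symm y = _
  rw [ChartedSpace.sum_chartAt_inl]
  rfl

lemma chart_sum_inr_symm {n : ℕ} (M M' : Mfd n) (x₀ : M'.carrier) (y : Euc n) :
    ((M.sum M').chart (Sum.inr x₀)).symm y = Sum.inr ((M'.chart x₀).symm y) := by
  change (chartAt (Euc n) (Sum.inr x₀ : M.carrier ⊕ M'.carrier)).symm y = _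
  rw [ChartedSpace.sum_chartAt_inr]
  rfl

lemma chart_sum_inl_target {n : ℕ} (M M' : Mfd n) (x₀ : M.carrier) :
    ((M.sum M').chart (Sum.inl x₀)).target = (M.chart x₀).target := by
  change (chartAt (Euc n) (Sum.inl x₀ : M.carrier ⊕ M'.carrier)).target = _
  rw [ChartedSpace.sum_chartAt_inl]
  rfl

lemma chart_sum_inr_target {n : ℕ} (M M' : Mfd n) (x₀ : M'.carrier) :
    ((M.sum M').chart (Sum.inr x₀)).target = (M'.chart x₀).target := by
  change (chartAt (Euc n) (Sum.inr x₀ : M.carrier ⊕ M'.carrier)).target = _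
  rw [ChartedSpace.sum_chartAt_inr]
  rfl

lemma transition_sum_inl {n : ℕ} (M M' : Mfd n) (x x₀ : M.carrier) :
    (fun z => (M.sum M').chart (Sum.inl x) (((M.sum M').chart (Sum.inl x₀)).symm z))
      = fun z => M.chart x ((M.chart x₀).symm z) := by
  funext z
  rw [chart_sum_inl_symm]
  exact sum_chartAt_inl_apply

lemma transition_sum_inr {n : ℕ} (M M' : Mfd n) (x x₀ : M'.carrier) :
    (fun z => (M.sum M').chart (Sum.inr x) (((M.sum M').chart (Sum.inr x₀)).symm z))
      = fun z => M'.chart x ((M'.chart x₀).symm z) := by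
  funext z
  rw [chart_sum_inr_symm]
  exact sum_chartAt_inr_apply

lemma comp_sumField_inl {n : ℕ} {M M' : Mfd n} (T : FormField M) (T' : FormField M')
    (x₀ : M.carrier) (i j : Fin n) : comp (sumField T T') (Sum.inl x₀) i j = comp T x₀ i j := by
  funext y
  have key : ∀ w, w = Sum.inl ((M.chart x₀).symm y) →
      (sumField T T') w
        (fderiv ℝ (fun z => (M.sum M').chart w (((M.sum M').chart (Sum.inl x₀)).symm z)) y
          (stdVec i))
        (fderiv ℝ (fun z => (M.sum M').chart w (((M.sum M').chart (Sum.inl x₀)).symm z)) y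
          (stdVec j)) = comp T x₀ i j y := by
    rintro w rfl
    rw [transition_sum_inl]
    rfl
  exact key _ (chart_sum_inl_symm M M' x₀ y)

lemma comp_sumField_inr {n : ℕ} {M M' : Mfd n} (T : FormField M) (T' : FormField M')
    (x₀ : M'.carrier) (i j : Fin n) :
    comp (sumField T T') (Sum.inr x₀) i j = comp T' x₀ i j := by
  funext y
  have key : ∀ w, w = Sum.inr ((M'.chart x₀).symm y) →
      (sumField T T') w
        (fderiv ℝ (fun z => (M.sum M').chart w (((M.sum M').chart (Sum.inr x₀)).symm z)) y
          (stdVec i))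
        (fderiv ℝ (fun z => (M.sum M').chart w (((M.sum M').chart (Sum.inr x₀)).symm z)) y
          (stdVec j)) = comp T' x₀ i j y := by
    rintro w rfl
    rw [transition_sum_inr]
    rfl
  exact key _ (chart_sum_inr_symm M M' x₀ y)

/-- The tensor field `g ⊕ g'` on `M ⊔ M'`. -/
def SobolevField.sum {n : ℕ} {p : ℝ≥0∞} {M M' : Mfd n} (g : SobolevField n p M)
    (g' : SobolevField n p M') : SobolevField n p (M.sum M') where
  toFun := sumField g.toFun g'.toFun
  symm
    | Sum.inl x => g.symm x
    | Sum.inr x => g'.symm x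
  cont
    | Sum.inl x₀, i, j => by
        rw [comp_sumField_inl, chart_sum_inl_target]; exact g.cont x₀ i j
    | Sum.inr x₀, i, j => by
        rw [comp_sumField_inr, chart_sum_inr_target]; exact g'.cont x₀ i j
  mem
    | Sum.inl x₀, i, j => by
        rw [comp_sumField_inl, chart_sum_inl_target]; exact g.mem x₀ i j
    | Sum.inr x₀, i, j => by
        rw [comp_sumField_inr, chart_sum_inr_target]; exact g'.mem x₀ i j

/-! ### Metrics and variational configurations -/

/-- `B` is an inner product of signature `(r, s)`: in some basis it is the diagonal form with `r`
entries `-1` and `s` entries `1`. -/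
def IsInnerOfSignature (r s : ℕ) {V : Type*} [AddCommGroup V] [Module ℝ V]
    (B : LinearMap.BilinForm ℝ V) : Prop :=
  ∃ b : Module.Basis (Fin r ⊕ Fin s) ℝ V,
    ∀ i j, B (b i) (b j) = if i = j then Sum.elim (fun _ => -1) (fun _ => 1) i else 0

/-- The field is a metric of signature `(r, s)`; for elements of `W^{2,p}_loc(Sym M)` this is
membership in `W^{2,p}_loc(Sgn M)`, the set of admissible metrics of `M`. -/
def IsMetric (r s : ℕ) {n : ℕ} {M : Mfd n} (T : FormField M) : Prop :=
  ∀ x, IsInnerOfSignature r s (T x)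

/-- Variational configurations `(M, g; Ω)`: an admissible metric `g` on a manifold `M`, and a
precompact open subset `Ω` of `M`. They form the domain of the Einstein-Hilbert action. -/
structure Config (n : ℕ) (p : ℝ≥0∞) (r s : ℕ) : Type 1 where
  M : Mfd n
  g : SobolevField n p M
  isMetric : IsMetric r s g.toFun
  Ω : Set M.carrier
  isOpen : IsOpen Ω
  precompact : IsCompact (closure Ω)

/-! ### The Einstein-Hilbert action -/

/-- The scalar curvature in coordinates, from the components `G i j` of the metric at a point and
their partial derivatives `G₁ k i j = ∂ₖ gᵢⱼ` and `G₂ k l i j = ∂ₖ ∂ₗ gᵢⱼ` at that point. With the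
Christoffel symbols `Γᵉₐᵦ` of the Levi-Civita connection, the curvature tensor has components
`R_{abcd} = ½ (∂_b ∂_c g_{ad} + ∂_a ∂_d g_{bc} - ∂_a ∂_c g_{bd} - ∂_b ∂_d g_{ac})
  + g_{ef} (Γᵉ_{bc} Γᶠ_{ad} - Γᵉ_{bd} Γᶠ_{ac})`, and `R = g^{ac} g^{bd} R_{abcd}`. -/
def scalarCurvature {n : ℕ} (G : Matrix (Fin n) (Fin n) ℝ) (G₁ : Fin n → Fin n → Fin n → ℝ)
    (G₂ : Fin n → Fin n → Fin n → Fin n → ℝ) : ℝ :=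
  let Γ : Fin n → Fin n → Fin n → ℝ := fun e a b =>
    (1 / 2) * ∑ d, G⁻¹ e d * (G₁ a d b + G₁ b d a - G₁ d a b)
  let Riem : Fin n → Fin n → Fin n → Fin n → ℝ := fun a b c d =>
    (1 / 2) * (G₂ b c a d + G₂ a d b c - G₂ a c b d - G₂ b d a c)
      + ∑ e, ∑ f, G e f * (Γ e b c * Γ f a d - Γ e b d * Γ f a c)
  ∑ a, ∑ b, ∑ c, ∑ d, G⁻¹ a c * G⁻¹ b d * Riem a b c d

/-- The Einstein-Hilbert Lagrangian density `R[g] |det gᵢⱼ|^{1/2}` in the chart at `x₀`, as a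
function of the coordinates. -/
def lagrangian {n : ℕ} {M : Mfd n} (g : FormField M) (x₀ : M.carrier) (y : Euc n) : ℝ :=
  let G : Matrix (Fin n) (Fin n) ℝ := Matrix.of fun i j => comp g x₀ i j y
  scalarCurvature G (fun k i j => comp₁ g x₀ k i j y) (fun k l i j => comp₂ g x₀ k l i j y)
    * √|G.det|

lemma exists_chart_cover {n : ℕ} (M : Mfd n) {Ω : Set M.carrier} (hΩ : IsCompact (closure Ω)) :
    ∃ t : Finset M.carrier, closure Ω ⊆ ⋃ x ∈ t, (M.chart x).source := by
  obtain ⟨t, -, ht⟩ := hΩ.elim_nhds_subcover (fun x => (M.chart x).source)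
    (fun x _ => chart_source_mem_nhds (Euc n) x)
  exact ⟨t, ht⟩

open Classical in
/-- The integral over a precompact set `Ω` of a density on `M` that is given by its coordinate
expressions `L x₀` in the charts at the points `x₀`. The closure of `Ω` is covered by the domains
of finitely many charts, and the functions `1 / #{charts of the cover around the point}` on these
domains are the partition of unity that is used. The value does not depend on the cover, as `L`
transforms like a density. -/
def integrateDensity {n : ℕ} (M : Mfd n) {Ω : Set M.carrier} (hΩ : IsCompact (closure Ω))
    (L : M.carrier → Euc n → ℝ) : ℝ :=
  let t := (exists_chart_cover M hΩ).choose
  ∑ x₀ ∈ t, ∫ y in (M.chart x₀).target ∩ (M.chart x₀).symm ⁻¹' Ω,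
    L x₀ y / ({x ∈ t | (M.chart x₀).symm y ∈ (M.chart x).source}.card : ℝ)

/-- The Einstein-Hilbert action `S_EH[M, g; Ω]`. -/
def einsteinHilbert {n : ℕ} {p : ℝ≥0∞} {r s : ℕ} (c : Config n p r s) : ℝ :=
  integrateDensity c.M c.precompact (lagrangian c.g.toFun)

/-! ### Disconnected topological variations and the topology they generate -/

/-- The configuration `(M ⊔ M', g ⊕ g'; Ω ⊔ M')`, for a closed manifold `M'`. -/
def Config.addComponent {n : ℕ} {p : ℝ≥0∞} {r s : ℕ} (c : Config n p r s) (M' : Mfd n)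
    [CompactSpace M'.carrier] (g' : SobolevField n p M') (hg' : IsMetric r s g'.toFun) :
    Config n p r s where
  M := c.M.sum M'
  g := c.g.sum g'
  isMetric
    | Sum.inl x => c.isMetric x
    | Sum.inr x => hg' x
  Ω := (Sum.inl '' c.Ω ∪ range Sum.inr : Set (c.M.carrier ⊕ M'.carrier))
  isOpen := (isOpenMap_inl _ c.isOpen).union isOpen_range_inr
  precompact := by
    change IsCompact (closure (Sum.inl '' c.Ω ∪ range Sum.inr : Set (c.M.carrier ⊕ M'.carrier)))
    rw [closure_union, IsClosedEmbedding.inl.closure_image_eq,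
      IsClosedEmbedding.inr.isClosed_range.closure_eq]
    exact (c.precompact.image continuous_inl).union (isCompact_range continuous_inr)

/-- The largest set of admissible geometric variations of `(M, g; Ω)`: the fields
`h ∈ W^{2,p}_c(Sym Ω)` such that `g + h` is a metric of signature `(r, s)`. It has the subspace
topology. -/
abbrev GeomVariation {n : ℕ} {p : ℝ≥0∞} {r s : ℕ} (c : Config n p r s) : Type :=
  {h : SobolevField n p c.M //
    (IsCompact (closure {x | h.toFun x ≠ 0}) ∧ closure {x | h.toFun x ≠ 0} ⊆ c.Ω) ∧
    IsMetric r s (c.g.add h).toFun}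

/-- The configuration `(M, g + h; Ω)`. -/
def Config.vary {n : ℕ} {p : ℝ≥0∞} {r s : ℕ} (c : Config n p r s) (h : GeomVariation c) :
    Config n p r s where
  M := c.M
  g := c.g.add h.1
  isMetric := h.2.2
  Ω := c.Ω
  isOpen := c.isOpen
  precompact := c.precompact

/-- The set `W^{2,p}(Sgn M') ∪ {0}` of the metrics of signature `(r, s)` on `M'` together with the
zero tensor field, with the subspace topology of `W^{2,p}(Sym M')`. -/
abbrev MetricOrZero (n : ℕ) (p : ℝ≥0∞) (r s : ℕ) (M' : Mfd n) : Type :=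
  {g' : SobolevField n p M' // (∀ x, g'.toFun x = 0) ∨ IsMetric r s g'.toFun}

open Classical in
/-- The variational map `(h, g') ↦ (M ⊔ M', (g + h) ⊕ g'; Ω ⊔ M')`, with the convention that the
component `M'` is absent when it carries the zero field: `(h, 0) ↦ (M, g + h; Ω)`. -/
def variationalMap {n : ℕ} {p : ℝ≥0∞} {r s : ℕ} (c : Config n p r s) (M' : Mfd n)
    [CompactSpace M'.carrier] (a : GeomVariation c × MetricOrZero n p r s M') : Config n p r s :=
  if h0 : ∀ x, a.2.1.toFun x = 0 then c.vary a.1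
  else (c.vary a.1).addComponent M' a.2.1 (a.2.2.resolve_left h0)

/-- The topology `τ₀`: the final topology on the set of configurations with respect to all
variational maps, for all configurations `(M, g; Ω)` and all closed manifolds `M'`. -/
abbrev tau₀ (n : ℕ) (p : ℝ≥0∞) (r s : ℕ) : TopologicalSpace (Config n p r s) :=
  ⨆ (c : Config n p r s) (M' : Mfd n) (_ : CompactSpace M'.carrier),
    TopologicalSpace.coinduced (variationalMap c M') inferInstance

end TopVar

end

/-! Near a configuration with zero action one can attach a closed component whose metric tends to
the zero tensor, while its action keeps a fixed nonzero value. By the definition of the variational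
maps the limit of such configurations is the one without the extra component, so continuity would
force that nonzero value to equal zero. This is `not_continuous_einsteinHilbert`. As `tau₀` is a
final topology, it suffices to break continuity along one variational map, with base configuration
the unit ball in flat space and with `h = 0`.

What remains is a closed manifold and a sequence of metrics on it that shrink to zero with constant
nonzero action.

For `n = 2` the excluded signature leaves only definite metrics. The action is then invariant under
constant rescaling, so multiples of the round metric on the sphere (or of its negative) will do: the
factor tends to zero and the total curvature stays (`lagrangian_roundField`, `integral_sphere_pos`).

For `n ≥ 3` a constant rescaling multiplies the action by a positive power of the factor, so an
anisotropic one is used. On the torus take `± N dt² + ∑ ± δ w(t)² dxᵢ²`. The scalar curvature is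
proportional to `1 / N` and does not see `δ`, while the volume density is proportional to `N^{1/2}
δ^{(n-1)/2}`. With `δ = λ²` and `N = λ^{2(n-1)}` all powers of `λ` cancel, although both
coefficients tend to zero with `λ` (`lagrangian_torusField`). After integration by parts the action
is `± (n-1)(n-2) ∫ w^{n-3} w'²`, which is nonzero for nonconstant `w` as `n ≥ 3`
(`integral_warpDensity_pos`). The signs of the directions `xᵢ` cancel, so every signature is
covered.

All metrics involved are smooth, so weak derivatives agree almost everywhere with classical ones
(`lagrangian_ae_eq`). The chosen cover in the definition of the action is harmless, because on the
sphere and the torus each chart domain has full measure in every other chart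
(`integrateDensity_sum`). -/

namespace TopVar

/-! ### Weak derivatives: uniqueness, and agreement with classical derivatives. -/

section SobolevCalculus

variable {n : ℕ} {U : Set (Euc n)} {k : Fin n} {f f' g a b : Euc n → ℝ} {p : ℝ≥0∞}

lemma integrable_mul_of_tsupport_subset {ψ : Euc n → ℝ} (hf : LocallyIntegrableOn f U)
    (hψ : Continuous ψ) (hc : HasCompactSupport ψ) (hs : tsupport ψ ⊆ U) :
    Integrable (fun y => f y * ψ y) := by
  have h1 : IntegrableOn (fun y => f y * ψ y) (tsupport ψ) :=
    (hf.integrableOn_compact_subset hs hc).mul_continuousOn hψ.continuousOn hc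
  rw [← integrableOn_iff_integrable_of_support_subset (s := tsupport ψ)]
  · exact h1
  · intro y hy
    apply subset_tsupport
    intro h0
    exact hy (by simp [h0])

lemma locallyIntegrableOn_congr_ae (hfg : f =ᵐ[volume.restrict U] g)
    (hf : LocallyIntegrableOn f U) : LocallyIntegrableOn g U := by
  intro x hx
  obtain ⟨s, hs, hi⟩ := hf x hx
  refine ⟨s ∩ U, Filter.inter_mem hs self_mem_nhdsWithin, ?_⟩
  exact (hi.mono_set inter_subset_left).congr
    (ae_mono (Measure.restrict_mono inter_subset_right le_rfl) hfg)

lemma IsWeakDeriv.congr_ae (hfg : f =ᵐ[volume.restrict U] g)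
    (hf : IsWeakDeriv U k f a) : IsWeakDeriv U k g a := by
  refine ⟨locallyIntegrableOn_congr_ae hfg hf.1, hf.2.1, fun φ h1 h2 h3 => ?_⟩
  rw [← hf.2.2 φ h1 h2 h3]
  apply integral_congr_ae
  filter_upwards [hfg] with y hy
  rw [hy]

/-- The fundamental lemma of the calculus of variations, applied to the difference of the two
derivatives. -/
lemma IsWeakDeriv.unique (hU : IsOpen U) (ha : IsWeakDeriv U k f a) (hb : IsWeakDeriv U k f b) :
    a =ᵐ[volume.restrict U] b := by
  have key : ∀ᵐ x ∂(volume : Measure (Euc n)), x ∈ U → (a - b) x = 0 := by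
    refine hU.ae_eq_zero_of_integral_contDiff_smul_eq_zero (ha.2.1.sub hb.2.1) ?_
    intro φ h1 h2 h3
    have e1 := ha.2.2 φ h1 h2 h3
    have e2 := hb.2.2 φ h1 h2 h3
    have hz : ∫ y, φ y • (a - b) y = ∫ y in U, φ y • (a - b) y := by
      rw [setIntegral_eq_integral_of_forall_compl_eq_zero]
      intro y hy
      rw [image_eq_zero_of_notMem_tsupport fun h => hy (h3 h), zero_smul]
    rw [hz]
    have e3 : ∀ y, φ y • (a - b) y = a y * φ y - b y * φ y := fun y => by
      simp only [smul_eq_mul, Pi.sub_apply]; ring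
    simp_rw [e3]
    rw [integral_sub (integrable_mul_of_tsupport_subset ha.2.1 h1.continuous h2 h3).restrict
      (integrable_mul_of_tsupport_subset hb.2.1 h1.continuous h2 h3).restrict]
    linarith
  filter_upwards [(ae_restrict_iff' hU.measurableSet).2 key] with y hy
  exact sub_eq_zero.1 hy

lemma isWeakDeriv_weakDeriv (h : ∃ f', IsWeakDeriv U k f f') :
    IsWeakDeriv U k f (weakDeriv U k f) := by
  rw [weakDeriv, dif_pos h]
  exact h.choose_spec

lemma IsWeakDeriv.weakDeriv_ae_eq (hU : IsOpen U) (h : IsWeakDeriv U k f f') :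
    weakDeriv U k f =ᵐ[volume.restrict U] f' :=
  (isWeakDeriv_weakDeriv ⟨f', h⟩).unique hU h

/-- The default value `0` makes this unconditional, so that measurability below needs no case
distinction on the existence of a derivative. -/
lemma locallyIntegrableOn_weakDeriv : LocallyIntegrableOn (weakDeriv U k f) U := by
  by_cases h : ∃ f', IsWeakDeriv U k f f'
  · exact (isWeakDeriv_weakDeriv h).2.1
  · rw [weakDeriv, dif_neg h]
    exact locallyIntegrableOn_zero

lemma IsWeakDeriv.const_mul (c : ℝ) (h : IsWeakDeriv U k f f') :
    IsWeakDeriv U k (fun y => c * f y) (fun y => c * f' y) := by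
  refine ⟨h.1.smul c, h.2.1.smul c, fun φ h1 h2 h3 => ?_⟩
  simp_rw [mul_assoc]
  rw [integral_const_mul, integral_const_mul, h.2.2 φ h1 h2 h3]
  ring

lemma contDiffOn_partialDeriv (hU : IsOpen U) (hf : ContDiffOn ℝ ∞ f U) (k : Fin n) :
    ContDiffOn ℝ ∞ (fun y => fderiv ℝ f y (stdVec k)) U :=
  (hf.fderiv_of_isOpen hU (by simp)).clm_apply contDiffOn_const

lemma isWeakDeriv_of_contDiffOn (hU : IsOpen U) (hf : ContDiffOn ℝ ∞ f U) (k : Fin n) :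
    IsWeakDeriv U k f (fun y => fderiv ℝ f y (stdVec k)) := by
  have hf' := contDiffOn_partialDeriv hU hf k
  have l1 := hf.continuousOn.locallyIntegrableOn hU.measurableSet (μ := volume)
  have l2 := hf'.continuousOn.locallyIntegrableOn hU.measurableSet (μ := volume)
  refine ⟨l1, l2, fun φ h1 h2 h3 => ?_⟩
  have hDs := tsupport_fderiv_apply_subset φ (stdVec k)
  have i1 : Integrable fun y => f y * fderiv ℝ φ y (stdVec k) :=
    integrable_mul_of_tsupport_subset l1
      ((h1.continuous_fderiv (by simp)).clm_apply continuous_const)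
      (IsCompact.of_isClosed_subset h2 (isClosed_tsupport _) hDs) (hDs.trans h3)
  have i2 : Integrable fun y => fderiv ℝ f y (stdVec k) * φ y :=
    integrable_mul_of_tsupport_subset l2 h1.continuous h2 h3
  have i3 : Integrable fun y => f y * φ y :=
    integrable_mul_of_tsupport_subset l1 h1.continuous h2 h3
  rw [setIntegral_eq_integral_of_forall_compl_eq_zero,
    setIntegral_eq_integral_of_forall_compl_eq_zero]
  -- Integration by parts on the whole space; `f` has to be differentiable only on the support of
  -- `φ`, which lies in `U`.
  · refine integral_bilinear_hasLineDerivAt_right_eq_neg_left_of_integrable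
      (B := ContinuousLinearMap.mul ℝ ℝ) (v := stdVec k) i2 i1 i3 ?_ ?_
    · intro x hx
      exact (((hf.contDiffAt (hU.mem_nhds (h3 hx))).differentiableAt
        (by simp)).hasFDerivAt).hasLineDerivAt _
    · intro x _
      exact ((h1.differentiable (by simp) x).hasFDerivAt).hasLineDerivAt _
  · intro y hy
    rw [image_eq_zero_of_notMem_tsupport fun h => hy (h3 h), mul_zero]
  · intro y hy
    have := image_eq_zero_of_notMem_tsupport fun h => hy (h3 (hDs h))
    rw [this, mul_zero]

lemma memLpLoc_of_continuousOn (hf : ContinuousOn f U) : MemLpLoc p U f := by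
  intro K hK hc
  have : IsFiniteMeasure (volume.restrict K) := ⟨by simpa using hc.measure_lt_top⟩
  obtain ⟨C, hC⟩ := hc.exists_bound_of_continuousOn (hf.mono hK)
  exact MemLp.of_bound ((hf.mono hK).aestronglyMeasurable hc.measurableSet) C
    ((ae_restrict_iff' hc.measurableSet).2 (Filter.Eventually.of_forall hC))

lemma memW2pLoc_of_contDiffOn (hU : IsOpen U) (hf : ContDiffOn ℝ ∞ f U) : MemW2pLoc p U f :=
  ⟨memLpLoc_of_continuousOn hf.continuousOn, fun k y => fderiv ℝ f y (stdVec k),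
    fun k l y => fderiv ℝ (fun z => fderiv ℝ f z (stdVec l)) y (stdVec k),
    fun k => ⟨isWeakDeriv_of_contDiffOn hU hf k,
      memLpLoc_of_continuousOn (contDiffOn_partialDeriv hU hf k).continuousOn⟩,
    fun k l => ⟨isWeakDeriv_of_contDiffOn hU (contDiffOn_partialDeriv hU hf l) k,
      memLpLoc_of_continuousOn
        (contDiffOn_partialDeriv hU (contDiffOn_partialDeriv hU hf l) k).continuousOn⟩⟩

lemma MemW2pLoc.isWeakDeriv (hU : IsOpen U) (hf : MemW2pLoc p U f) (k : Fin n) :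
    IsWeakDeriv U k f (weakDeriv U k f) ∧ MemLpLoc p U (weakDeriv U k f) := by
  obtain ⟨-, f₁, f₂, h1, -⟩ := hf
  refine ⟨isWeakDeriv_weakDeriv ⟨_, (h1 k).1⟩, fun K hK hc => ?_⟩
  exact (memLp_congr_ae (ae_mono (Measure.restrict_mono hK le_rfl)
    ((h1 k).1.weakDeriv_ae_eq hU))).2 ((h1 k).2 K hK hc)

/-- The witness `f₂ k l` differentiates the witness `f₁ l`, not the chosen `weakDeriv U l f`; the
two agree almost everywhere, and weak derivatives do not see the difference. -/
lemma MemW2pLoc.isWeakDeriv₂ (hU : IsOpen U) (hf : MemW2pLoc p U f) (k l : Fin n) :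
    IsWeakDeriv U k (weakDeriv U l f) (weakDeriv U k (weakDeriv U l f)) ∧
      MemLpLoc p U (weakDeriv U k (weakDeriv U l f)) := by
  obtain ⟨-, f₁, f₂, h1, h2⟩ := hf
  have h : IsWeakDeriv U k (weakDeriv U l f) (f₂ k l) :=
    (h2 k l).1.congr_ae ((h1 l).1.weakDeriv_ae_eq hU).symm
  refine ⟨isWeakDeriv_weakDeriv ⟨_, h⟩, fun K hK hc => ?_⟩
  exact (memLp_congr_ae (ae_mono (Measure.restrict_mono hK le_rfl)
    (h.weakDeriv_ae_eq hU))).2 ((h2 k l).2 K hK hc)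

/-- On functions that are smooth on `U`, the weak derivative is the classical one. -/
lemma weakDeriv_ae_eq_of_eqOn (hU : IsOpen U) (hf : ContDiffOn ℝ ∞ f U) (hg : EqOn g f U)
    (k : Fin n) : weakDeriv U k g =ᵐ[volume.restrict U] fun y => fderiv ℝ f y (stdVec k) :=
  ((isWeakDeriv_of_contDiffOn hU hf k).congr_ae
    ((ae_restrict_iff' hU.measurableSet).2
      (Filter.Eventually.of_forall fun _ hy => (hg hy).symm))).weakDeriv_ae_eq hU

lemma weakDeriv₂_ae_eq_of_eqOn (hU : IsOpen U) (hf : ContDiffOn ℝ ∞ f U) (hg : EqOn g f U)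
    (k l : Fin n) : weakDeriv U k (weakDeriv U l g) =ᵐ[volume.restrict U]
      fun y => fderiv ℝ (fun z => fderiv ℝ f z (stdVec l)) y (stdVec k) :=
  ((isWeakDeriv_of_contDiffOn hU (contDiffOn_partialDeriv hU hf l) k).congr_ae
    (weakDeriv_ae_eq_of_eqOn hU hf hg l).symm).weakDeriv_ae_eq hU

end SobolevCalculus

/-! ### Convergence to the zero field in the Sobolev topology. -/

section Convergence

variable {n : ℕ} {p : ℝ≥0∞} {M : Mfd n}

lemma aestronglyMeasurable_of_locallyIntegrableOn {U K : Set (Euc n)} {f : Euc n → ℝ}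
    (hf : LocallyIntegrableOn f U) (hK : K ⊆ U) (hc : IsCompact K) :
    AEStronglyMeasurable f (volume.restrict K) :=
  (hf.integrableOn_compact_subset hK hc).aestronglyMeasurable

/-- Minkowski's inequality, term by term; this is where `1 ≤ p` enters. It is needed because the
generating balls of the topology have arbitrary centres. -/
lemma sobolevDist_triangle (hp : 1 ≤ p) (x₀ : M.carrier) {K : Set (Euc n)} (hc : IsCompact K)
    (hK : K ⊆ (M.chart x₀).target) (A B C : SobolevField n p M) :
    sobolevDist p x₀ K A.toFun C.toFun
      ≤ sobolevDist p x₀ K A.toFun B.toFun + sobolevDist p x₀ K B.toFun C.toFun := by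
  have key : ∀ {f g h : Euc n → ℝ}, AEStronglyMeasurable f (volume.restrict K) →
      AEStronglyMeasurable g (volume.restrict K) → AEStronglyMeasurable h (volume.restrict K) →
      eLpNorm (f - h) p (volume.restrict K)
        ≤ eLpNorm (f - g) p (volume.restrict K) + eLpNorm (g - h) p (volume.restrict K) := by
    intro f g h hf hg hh
    have := eLpNorm_add_le (hf.sub hg) (hg.sub hh) hp
    rwa [sub_add_sub_cancel] at this
  have m0 : ∀ (T : SobolevField n p M) i j,
      AEStronglyMeasurable (comp T.toFun x₀ i j) (volume.restrict K) := fun T i j =>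
    ((T.cont x₀ i j).mono hK).aestronglyMeasurable hc.measurableSet
  have m1 : ∀ (T : SobolevField n p M) k i j,
      AEStronglyMeasurable (comp₁ T.toFun x₀ k i j) (volume.restrict K) := fun T k i j =>
    aestronglyMeasurable_of_locallyIntegrableOn locallyIntegrableOn_weakDeriv hK hc
  have m2 : ∀ (T : SobolevField n p M) k l i j,
      AEStronglyMeasurable (comp₂ T.toFun x₀ k l i j) (volume.restrict K) := fun T k l i j =>
    aestronglyMeasurable_of_locallyIntegrableOn locallyIntegrableOn_weakDeriv hK hc
  simp only [sobolevDist, ← Finset.sum_add_distrib]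
  refine Finset.sum_le_sum fun i _ => Finset.sum_le_sum fun j _ => ?_
  refine (add_le_add (add_le_add (key (m0 A i j) (m0 B i j) (m0 C i j))
    (Finset.sum_le_sum fun k _ => key (m1 A k i j) (m1 B k i j) (m1 C k i j)))
    (Finset.sum_le_sum fun k _ => Finset.sum_le_sum fun l _ =>
      key (m2 A k l i j) (m2 B k l i j) (m2 C k l i j))).trans_eq ?_
  simp only [Finset.sum_add_distrib]
  ring

lemma comp_eq_zero {T : FormField M} (hT : ∀ x, T x = 0) (x₀ : M.carrier) (i j : Fin n) :
    comp T x₀ i j = 0 := by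
  funext y
  simp [comp, hT]

/-- Sequences of fields whose components are multiples of those of one field, by factors that tend
to zero, converge to zero. -/
lemma tendsto_of_comp_eq_mul (hp : 1 ≤ p) (T Z : SobolevField n p M) (S : ℕ → SobolevField n p M)
    (c : ℕ → Fin n → Fin n → ℝ)
    (hc : ∀ i j, Filter.Tendsto (fun m => c m i j) Filter.atTop (𝓝 0))
    (hS : ∀ m x₀ i j, ∀ y ∈ (M.chart x₀).target,
      comp (S m).toFun x₀ i j y = c m i j * comp T.toFun x₀ i j y)
    (hZ : ∀ x, Z.toFun x = 0) : Filter.Tendsto S Filter.atTop (𝓝 Z) := by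
  rw [TopologicalSpace.tendsto_nhds_generateFrom_iff]
  rintro _ ⟨x₀, K, A, ε, hK, hKt, hε, rfl⟩ hZA
  have hU : IsOpen (M.chart x₀).target := (M.chart x₀).open_target
  have hres : volume.restrict K ≤ volume.restrict (M.chart x₀).target :=
    Measure.restrict_mono hKt le_rfl
  have toK : ∀ {f g : Euc n → ℝ}, f =ᵐ[volume.restrict (M.chart x₀).target] g →
      f =ᵐ[volume.restrict K] g := fun h => ae_mono hres h
  have e0 : ∀ m i j, comp (S m).toFun x₀ i j =ᵐ[volume.restrict (M.chart x₀).target]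
      fun y => c m i j * comp T.toFun x₀ i j y := fun m i j =>
    (ae_restrict_iff' hU.measurableSet).2 (Filter.Eventually.of_forall (hS m x₀ i j))
  have e1 : ∀ m k i j, comp₁ (S m).toFun x₀ k i j =ᵐ[volume.restrict (M.chart x₀).target]
      fun y => c m i j * comp₁ T.toFun x₀ k i j y := fun m k i j =>
    ((((T.mem x₀ i j).isWeakDeriv hU k).1.const_mul (c m i j)).congr_ae
      (e0 m i j).symm).weakDeriv_ae_eq hU
  have e2 : ∀ m k l i j, comp₂ (S m).toFun x₀ k l i j =ᵐ[volume.restrict (M.chart x₀).target]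
      fun y => c m i j * comp₂ T.toFun x₀ k l i j y := fun m k l i j =>
    ((((T.mem x₀ i j).isWeakDeriv₂ hU k l).1.const_mul (c m i j)).congr_ae
      (e1 m l i j).symm).weakDeriv_ae_eq hU
  have z0 : ∀ i j, comp Z.toFun x₀ i j = fun _ => 0 := fun i j => comp_eq_zero hZ x₀ i j
  have zd : ∀ k, IsWeakDeriv (M.chart x₀).target k (fun _ => (0 : ℝ)) (fun _ => 0) := fun k => by
    simpa using isWeakDeriv_of_contDiffOn hU (contDiffOn_const (c := (0 : ℝ))) k
  have z1 : ∀ k i j, comp₁ Z.toFun x₀ k i j =ᵐ[volume.restrict (M.chart x₀).target]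
      fun _ => 0 := fun k i j => by
    rw [comp₁, z0]; exact (zd k).weakDeriv_ae_eq hU
  have z2 : ∀ k l i j, comp₂ Z.toFun x₀ k l i j =ᵐ[volume.restrict (M.chart x₀).target]
      fun _ => 0 := fun k l i j =>
    ((zd k).congr_ae (z1 l i j).symm).weakDeriv_ae_eq hU
  -- Each of the seminorms that make up the distance scales by the absolute value of the factor of
  -- its component.
  have nrm : ∀ {f g h : Euc n → ℝ} (t : ℝ), f =ᵐ[volume.restrict (M.chart x₀).target]
      (fun y => t * h y) → g =ᵐ[volume.restrict (M.chart x₀).target] (fun _ => 0) →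
      eLpNorm (f - g) p (volume.restrict K) = ‖t‖ₑ * eLpNorm h p (volume.restrict K) := by
    intro f g h t hf hg
    have : f - g =ᵐ[volume.restrict K] t • h := by
      filter_upwards [toK hf, toK hg] with y h1 h2
      simp [h1, h2]
    rw [eLpNorm_congr_ae this, eLpNorm_const_smul]
  have dist_eq : ∀ m, sobolevDist p x₀ K (S m).toFun Z.toFun = ∑ i, ∑ j,
      (‖c m i j‖ₑ * eLpNorm (comp T.toFun x₀ i j) p (volume.restrict K)
      + ∑ k, ‖c m i j‖ₑ * eLpNorm (comp₁ T.toFun x₀ k i j) p (volume.restrict K)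
      + ∑ k, ∑ l, ‖c m i j‖ₑ * eLpNorm (comp₂ T.toFun x₀ k l i j) p (volume.restrict K)) := by
    intro m
    simp only [sobolevDist]
    refine Finset.sum_congr rfl fun i _ => Finset.sum_congr rfl fun j _ => ?_
    rw [nrm _ (e0 m i j) (by rw [z0])]
    congr 1
    · congr 1
      exact Finset.sum_congr rfl fun k _ => nrm _ (e1 m k i j) (z1 k i j)
    · exact Finset.sum_congr rfl fun k _ => Finset.sum_congr rfl fun l _ =>
        nrm _ (e2 m k l i j) (z2 k l i j)
  have lim : ∀ i j (h : Euc n → ℝ), MemLpLoc p (M.chart x₀).target h → Filter.Tendsto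
      (fun m => ‖c m i j‖ₑ * eLpNorm h p (volume.restrict K)) Filter.atTop (𝓝 0) := by
    intro i j h hh
    have h1 : Filter.Tendsto (fun m => ‖c m i j‖ₑ) Filter.atTop (𝓝 0) := by
      simpa using (hc i j).enorm
    simpa using ENNReal.Tendsto.mul_const h1 (Or.inr (hh K hKt hK).eLpNorm_ne_top)
  have dist_lim : Filter.Tendsto (fun m => sobolevDist p x₀ K (S m).toFun Z.toFun)
      Filter.atTop (𝓝 0) := by
    simp only [dist_eq]
    have := tendsto_finsetSum (Finset.univ : Finset (Fin n)) fun i _ =>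
      tendsto_finsetSum (Finset.univ : Finset (Fin n)) fun j _ =>
      ((lim i j _ (T.mem x₀ i j).1).add
        (tendsto_finsetSum (Finset.univ : Finset (Fin n)) fun k _ =>
          lim i j _ ((T.mem x₀ i j).isWeakDeriv hU k).2)).add
        (tendsto_finsetSum (Finset.univ : Finset (Fin n)) fun k _ =>
          tendsto_finsetSum (Finset.univ : Finset (Fin n)) fun l _ =>
          lim i j _ ((T.mem x₀ i j).isWeakDeriv₂ hU k l).2)
    simp only [add_zero, Finset.sum_const_zero] at this
    exact this
  -- A generating ball around `A` that contains `Z` contains `S m` once the distance from `S m` to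
  -- `Z` is below the remaining gap.
  have hZA' : sobolevDist p x₀ K Z.toFun A.toFun < ε := hZA
  have hlim := dist_lim.add_const (sobolevDist p x₀ K Z.toFun A.toFun)
  rw [zero_add] at hlim
  filter_upwards [hlim.eventually_lt_const hZA'] with m hm
  exact (sobolevDist_triangle hp x₀ hK hKt (S m) Z A).trans_lt hm

end Convergence

/-! ### The Lagrangian of smooth metrics and of disjoint unions. -/

section Lagrangian

variable {n : ℕ}

/-- For smooth components, the Lagrangian is given by classical derivatives. -/
lemma lagrangian_ae_eq {M : Mfd n} {T : FormField M} {x₀ : M.carrier}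
    (F : Fin n → Fin n → Euc n → ℝ)
    (hF : ∀ i j, ContDiffOn ℝ ∞ (F i j) (M.chart x₀).target)
    (hT : ∀ i j, EqOn (comp T x₀ i j) (F i j) (M.chart x₀).target) :
    lagrangian T x₀ =ᵐ[volume.restrict (M.chart x₀).target] fun y =>
      scalarCurvature (Matrix.of fun i j => F i j y)
        (fun k i j => fderiv ℝ (F i j) y (stdVec k))
        (fun k l i j => fderiv ℝ (fun z => fderiv ℝ (F i j) z (stdVec l)) y (stdVec k))
        * √|(Matrix.of fun i j => F i j y).det| := by
  have hU := (M.chart x₀).open_target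
  have h0 : ∀ᵐ y ∂(volume.restrict (M.chart x₀).target), ∀ i j, comp T x₀ i j y = F i j y :=
    (ae_restrict_iff' hU.measurableSet).2
      (Filter.Eventually.of_forall fun y hy i j => hT i j hy)
  have h1 : ∀ᵐ y ∂(volume.restrict (M.chart x₀).target), ∀ k i j,
      comp₁ T x₀ k i j y = fderiv ℝ (F i j) y (stdVec k) :=
    ae_all_iff.2 fun k => ae_all_iff.2 fun i => ae_all_iff.2 fun j =>
      weakDeriv_ae_eq_of_eqOn hU (hF i j) (hT i j) k
  have h2 : ∀ᵐ y ∂(volume.restrict (M.chart x₀).target), ∀ k l i j, comp₂ T x₀ k l i j y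
      = fderiv ℝ (fun z => fderiv ℝ (F i j) z (stdVec l)) y (stdVec k) :=
    ae_all_iff.2 fun k => ae_all_iff.2 fun l => ae_all_iff.2 fun i => ae_all_iff.2 fun j =>
      weakDeriv₂_ae_eq_of_eqOn hU (hF i j) (hT i j) k l
  filter_upwards [h0, h1, h2] with y e0 e1 e2
  simp only [lagrangian, e0, e1, e2]

lemma lagrangian_ae_eq_zero_of_const {M : Mfd n} {T : FormField M} {x₀ : M.carrier}
    (C : Fin n → Fin n → ℝ) (hT : ∀ i j, ∀ y ∈ (M.chart x₀).target, comp T x₀ i j y = C i j) :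
    lagrangian T x₀ =ᵐ[volume.restrict (M.chart x₀).target] 0 := by
  refine (lagrangian_ae_eq (fun i j _ => C i j) (fun i j => contDiffOn_const)
    (fun i j y hy => hT i j y hy)).trans (Filter.Eventually.of_forall fun y => ?_)
  simp [scalarCurvature]

lemma lagrangian_sumField_inl {M M' : Mfd n} (T : FormField M) (T' : FormField M')
    (x₀ : M.carrier) : lagrangian (sumField T T') (Sum.inl x₀) = lagrangian T x₀ := by
  funext y
  simp only [lagrangian, comp₂, comp₁, comp_sumField_inl, chart_sum_inl_target]

lemma lagrangian_sumField_inr {M M' : Mfd n} (T : FormField M) (T' : FormField M')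
    (x₀ : M'.carrier) : lagrangian (sumField T T') (Sum.inr x₀) = lagrangian T' x₀ := by
  funext y
  simp only [lagrangian, comp₂, comp₁, comp_sumField_inr, chart_sum_inr_target]

end Lagrangian

/-! ### The action in terms of Lagrangians, independently of the chosen cover. -/

section Action

variable {n : ℕ} {p : ℝ≥0∞} {r s : ℕ}

lemma setIntegral_div_eq_zero {U V : Set (Euc n)} (hUV : V ⊆ U) {L w : Euc n → ℝ}
    (hL : L =ᵐ[volume.restrict U] 0) : ∫ y in V, L y / w y = 0 := by
  rw [← integral_zero (Euc n) ℝ (μ := volume.restrict V)]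
  apply integral_congr_ae
  filter_upwards [ae_mono (Measure.restrict_mono hUV le_rfl) hL] with y hy
  simp [hy]

lemma einsteinHilbert_eq_zero (c : Config n p r s)
    (hc : ∀ x₀, lagrangian c.g.toFun x₀ =ᵐ[volume.restrict (c.M.chart x₀).target] 0) :
    einsteinHilbert c = 0 :=
  Finset.sum_eq_zero fun x₀ _ => setIntegral_div_eq_zero inter_subset_left (hc x₀)

lemma inr_notMem_chart_source {M M' : Mfd n} (a : M.carrier) (x : M'.carrier) :
    (Sum.inr x : M.carrier ⊕ M'.carrier) ∉ ((M.sum M').chart (Sum.inl a)).source := by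
  intro hx
  change _ ∈ (chartAt (Euc n) (Sum.inl a : M.carrier ⊕ M'.carrier)).source at hx
  rw [ChartedSpace.sum_chartAt_inl] at hx
  obtain ⟨_, -, h⟩ := hx
  exact Sum.inl_ne_inr h

lemma inr_mem_chart_source {M M' : Mfd n} (a x : M'.carrier) :
    (Sum.inr x : M.carrier ⊕ M'.carrier) ∈ ((M.sum M').chart (Sum.inr a)).source
      ↔ x ∈ (M'.chart a).source := by
  change _ ∈ (chartAt (Euc n) (Sum.inr a : M.carrier ⊕ M'.carrier)).source ↔ _
  rw [ChartedSpace.sum_chartAt_inr]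
  exact Sum.inr_injective.mem_set_image

-- Charts of `M` never contain points of `M'`, so the weight at a point common to all chosen charts
-- of `M'` is the number of those charts.
open Classical in
lemma card_filter_chart_source {M M' : Mfd n} (t : Finset (M.carrier ⊕ M'.carrier))
    (z : M'.carrier) (hz : ∀ x ∈ t.toRight, z ∈ (M'.chart x).source) :
    ({x ∈ t | (Sum.inr z : M.carrier ⊕ M'.carrier) ∈ ((M.sum M').chart x).source}).card
      = t.toRight.card := by
  rw [← Finset.card_map Function.Embedding.inr (s := t.toRight)]
  congr 1
  ext w
  constructor
  · intro h
    obtain ⟨hw, hwz⟩ := Finset.mem_filter.1 h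
    rcases w with b | b
    · exact absurd hwz (inr_notMem_chart_source b _)
    · exact Finset.mem_map.2 ⟨b, Finset.mem_toRight.2 hw, rfl⟩
  · intro h
    obtain ⟨b, hb, rfl⟩ := Finset.mem_map.1 h
    exact Finset.mem_filter.2 ⟨Finset.mem_toRight.1 hb, (inr_mem_chart_source b _).2 (hz b hb)⟩

/-- The integral over `M ⊔ M'` of a density that vanishes on `M`, when the charts of `M'` have
domains of full measure and the density has the same integral in all of them. -/
lemma integrateDensity_sum (M M' : Mfd n) [Nonempty M'.carrier]
    {Ω : Set (M.carrier ⊕ M'.carrier)} (hΩ : IsCompact (X := (M.sum M').carrier) (closure Ω))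
    (hr : ∀ x, Sum.inr x ∈ Ω) (L : M.carrier ⊕ M'.carrier → Euc n → ℝ)
    (hL : ∀ a, L (Sum.inl a) =ᵐ[volume.restrict (M.chart a).target] 0)
    (hfull : ∀ x x₀, ∀ᵐ y ∂(volume.restrict (M'.chart x₀).target),
      (M'.chart x₀).symm y ∈ (M'.chart x).source) (I : ℝ)
    (hI : ∀ x₀, ∫ y in (M'.chart x₀).target, L (Sum.inr x₀) y = I) :
    integrateDensity (M.sum M') hΩ L = I := by
  classical
  have hcov := (exists_chart_cover (M.sum M') hΩ).choose_spec
  unfold integrateDensity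
  -- Nothing is known about the chosen finite cover except that it covers.
  generalize (exists_chart_cover (M.sum M') hΩ).choose = t at hcov
  change Finset (M.carrier ⊕ M'.carrier) at t
  have hsum : ∀ f : M.carrier ⊕ M'.carrier → ℝ, ∑ x ∈ t, f x
      = ∑ x ∈ t.toLeft, f (Sum.inl x) + ∑ x ∈ t.toRight, f (Sum.inr x) := fun f => by
    conv_lhs => rw [← Finset.toLeft_disjSum_toRight (u := t), Finset.sum_disjSum]
  have hne : t.toRight.card ≠ 0 := by
    obtain ⟨x⟩ := ‹Nonempty M'.carrier›
    obtain ⟨z, hz, hzx⟩ := mem_iUnion₂.1 (hcov (subset_closure (hr x)))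
    rw [Finset.card_ne_zero]
    rcases z with a | a
    · exact absurd hzx (inr_notMem_chart_source a x)
    · exact ⟨a, Finset.mem_toRight.2 hz⟩
  refine (hsum _).trans ?_
  have hleft : ∀ (a : M.carrier) (w : Euc n → ℝ),
      ∫ y in ((M.sum M').chart (Sum.inl a)).target ∩
        ((M.sum M').chart (Sum.inl a)).symm ⁻¹' Ω, L (Sum.inl a) y / w y = 0 := by
    intro a w
    refine setIntegral_div_eq_zero inter_subset_left ?_
    rw [chart_sum_inl_target]
    exact hL a
  rw [Finset.sum_eq_zero fun a _ => hleft a _, zero_add]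
  -- Almost everywhere the weight is the constant number of chosen charts of `M'`, so each of them
  -- contributes an equal share of `I`.
  have hright : ∀ a : M'.carrier, ∫ y in ((M.sum M').chart (Sum.inr a)).target ∩
      ((M.sum M').chart (Sum.inr a)).symm ⁻¹' Ω, L (Sum.inr a) y /
      ({x ∈ t | ((M.sum M').chart (Sum.inr a)).symm y ∈ ((M.sum M').chart x).source}.card : ℝ)
        = I / t.toRight.card := by
    intro a
    have hset : ((M.sum M').chart (Sum.inr a)).target ∩
        ((M.sum M').chart (Sum.inr a)).symm ⁻¹' Ω = (M'.chart a).target := by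
      rw [← chart_sum_inr_target M M' a]
      refine inter_eq_left.2 fun y _ => ?_
      change ((M.sum M').chart (Sum.inr a)).symm y ∈ Ω
      rw [chart_sum_inr_symm]
      exact hr _
    rw [hset, ← hI a, ← integral_div]
    apply integral_congr_ae
    have hall : ∀ᵐ y ∂(volume.restrict (M'.chart a).target), ∀ x ∈ t.toRight,
        (M'.chart a).symm y ∈ (M'.chart x).source :=
      (Finset.eventually_all t.toRight).2 fun x _ => hfull x a
    filter_upwards [hall] with y hy
    congr 2
    rw [chart_sum_inr_symm]
    convert card_filter_chart_source t _ hy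
    rfl
  refine (Finset.sum_congr rfl fun a _ => ?_).trans
    (b := ∑ _a ∈ t.toRight, I / (t.toRight.card : ℝ)) ?_
  · convert hright a
  · rw [Finset.sum_const, nsmul_eq_mul]
    field_simp

/-- The action of a disjoint union with a configuration whose Lagrangian vanishes. -/
lemma einsteinHilbert_addComponent (c : Config n p r s)
    (hc : ∀ x₀, lagrangian c.g.toFun x₀ =ᵐ[volume.restrict (c.M.chart x₀).target] 0)
    (M' : Mfd n) [CompactSpace M'.carrier] [Nonempty M'.carrier] (g' : SobolevField n p M')
    (hg' : IsMetric r s g'.toFun)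
    (hfull : ∀ x x₀, ∀ᵐ y ∂(volume.restrict (M'.chart x₀).target),
      (M'.chart x₀).symm y ∈ (M'.chart x).source) (I : ℝ)
    (hI : ∀ x₀, ∫ y in (M'.chart x₀).target, lagrangian g'.toFun x₀ y = I) :
    einsteinHilbert (c.addComponent M' g' hg') = I := by
  refine integrateDensity_sum c.M M' _ (fun x => Or.inr ⟨x, rfl⟩)
    (lagrangian (sumField c.g.toFun g'.toFun)) (fun a => ?_) hfull I fun x₀ => ?_
  · rw [lagrangian_sumField_inl]; exact hc a
  · rw [lagrangian_sumField_inr]; exact hI x₀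

end Action

/-! ### The criterion for discontinuity. -/

section Discontinuity

variable {n : ℕ} {p : ℝ≥0∞} {r s : ℕ}

/-- The zero field. -/
noncomputable def zeroField (p : ℝ≥0∞) (M : Mfd n) : SobolevField n p M where
  toFun _ := 0
  symm _ _ _ := rfl
  cont x₀ i j := by
    rw [comp_eq_zero (fun _ => rfl)]; exact continuousOn_const
  mem x₀ i j := by
    rw [comp_eq_zero (fun _ => rfl)]
    exact memW2pLoc_of_contDiffOn (M.chart x₀).open_target contDiffOn_const

lemma add_zeroField_toFun {M : Mfd n} (g : SobolevField n p M) :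
    (g.add (zeroField p M)).toFun = g.toFun := by
  funext x
  exact add_zero _

/-- The trivial geometric variation. -/
noncomputable def zeroVariation (c : Config n p r s) : GeomVariation c :=
  ⟨zeroField p c.M, by simp [zeroField],
    fun x => by rw [add_zeroField_toFun]; exact c.isMetric x⟩

/-- The points `(0, S m)` converge to `(0, 0)` in the domain of one variational map. The action is
`I` at their images and `0` at the image of the limit, where the component `M'` has disappeared. -/
lemma not_continuous_einsteinHilbert (c : Config n p r s)
    (hc : ∀ x₀, lagrangian c.g.toFun x₀ =ᵐ[volume.restrict (c.M.chart x₀).target] 0)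
    (M' : Mfd n) [CompactSpace M'.carrier] [Nonempty M'.carrier]
    (S : ℕ → SobolevField n p M') (hS : ∀ m, IsMetric r s (S m).toFun)
    (hS0 : ∀ m x, (S m).toFun x ≠ 0)
    (hlim : Filter.Tendsto S Filter.atTop (𝓝 (zeroField p M')))
    (hfull : ∀ x x₀, ∀ᵐ y ∂(volume.restrict (M'.chart x₀).target),
      (M'.chart x₀).symm y ∈ (M'.chart x).source) (I : ℝ) (hI0 : I ≠ 0)
    (hI : ∀ m x₀, ∫ y in (M'.chart x₀).target, lagrangian (S m).toFun x₀ y = I) :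
    ¬ Continuous[tau₀ n p r s, inferInstance] (einsteinHilbert : Config n p r s → ℝ) := by
  intro hcont
  have h1 : Continuous (einsteinHilbert ∘ variationalMap c M' :
      GeomVariation c × MetricOrZero n p r s M' → ℝ) :=
    continuous_coinduced_dom.1 (continuous_iSup_dom.1 (continuous_iSup_dom.1
      (continuous_iSup_dom.1 hcont c) M') inferInstance)
  let Z : MetricOrZero n p r s M' := ⟨zeroField p M', Or.inl fun _ => rfl⟩
  let A : ℕ → MetricOrZero n p r s M' := fun m => ⟨S m, Or.inr (hS m)⟩
  have hA : Filter.Tendsto A Filter.atTop (𝓝 Z) := tendsto_subtype_rng.2 hlim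
  have h2 := (h1.tendsto (zeroVariation c, Z)).comp
    ((tendsto_const_nhds (x := zeroVariation c)).prodMk_nhds hA)
  have hcv : ∀ x₀, lagrangian (c.vary (zeroVariation c)).g.toFun x₀
      =ᵐ[volume.restrict (c.M.chart x₀).target] 0 := by
    intro x₀
    have : (c.vary (zeroVariation c)).g.toFun = c.g.toFun := add_zeroField_toFun c.g
    rw [this]
    exact hc x₀
  have hz : einsteinHilbert (variationalMap c M' (zeroVariation c, Z)) = 0 := by
    rw [variationalMap, dif_pos (show ∀ x, Z.1.toFun x = 0 from fun _ => rfl)]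
    exact einsteinHilbert_eq_zero _ hcv
  have hm : ∀ m, einsteinHilbert (variationalMap c M' (zeroVariation c, A m)) = I := by
    intro m
    -- Non-emptiness of `M'` matters here: on an empty manifold every field is the zero field.
    rw [variationalMap, dif_neg fun h => hS0 m (Classical.arbitrary _) (h _)]
    exact einsteinHilbert_addComponent _ hcv M' (S m) _ hfull I (hI m)
  have h3 : Filter.Tendsto (fun _ : ℕ => I) Filter.atTop (𝓝 0) := by
    rw [← hz]
    refine h2.congr fun m => ?_
    exact hm m
  exact hI0 (tendsto_nhds_unique tendsto_const_nhds h3)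

end Discontinuity

/-! ### Diagonal forms of given signature. -/

section DiagonalForms

variable {n : ℕ} {p : ℝ≥0∞} {r s : ℕ}

/-- The diagonal bilinear form with entries `d i`. -/
noncomputable def diagForm (d : Fin n → ℝ) : LinearMap.BilinForm ℝ (Euc n) :=
  LinearMap.mk₂ ℝ (fun v w => ∑ i, d i * v i * w i)
    (fun v v' w => by
      rw [← Finset.sum_add_distrib]
      exact Finset.sum_congr rfl fun i _ => by simp only [PiLp.add_apply]; ring)
    (fun a v w => by
      rw [smul_eq_mul, Finset.mul_sum]
      exact Finset.sum_congr rfl fun i _ => by simp only [PiLp.smul_apply, smul_eq_mul]; ring)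
    (fun v w w' => by
      rw [← Finset.sum_add_distrib]
      exact Finset.sum_congr rfl fun i _ => by simp only [PiLp.add_apply]; ring)
    (fun a v w => by
      rw [smul_eq_mul, Finset.mul_sum]
      exact Finset.sum_congr rfl fun i _ => by simp only [PiLp.smul_apply, smul_eq_mul]; ring)

lemma diagForm_apply (d : Fin n → ℝ) (v w : Euc n) :
    diagForm d v w = ∑ i, d i * v i * w i := rfl

lemma diagForm_symm (d : Fin n → ℝ) (v w : Euc n) : diagForm d v w = diagForm d w v := by
  simp only [diagForm_apply]
  exact Finset.sum_congr rfl fun i _ => by ring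

lemma diagForm_stdVec (d : Fin n → ℝ) (i j : Fin n) :
    diagForm d (stdVec i) (stdVec j) = if i = j then d i else 0 := by
  simp only [diagForm_apply, stdVec, PiLp.single_apply]
  by_cases hij : i = j
  · subst hij; simp
  · simp [hij, Ne.symm hij]

/-- The signs of the diagonal form of signature `(r, s)`. -/
def signs (h : r + s = n) (i : Fin n) : ℝ :=
  Sum.elim (fun _ => -1) (fun _ => 1) ((finSumFinEquiv.trans (finCongr h)).symm i)

lemma signs_mul_self (h : r + s = n) (i : Fin n) : signs h i * signs h i = 1 := by
  unfold signs
  rcases (finSumFinEquiv.trans (finCongr h)).symm i with a | a <;> simp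

lemma isInnerOfSignature_diagForm (h : r + s = n) (a : Fin n → ℝ) (ha : ∀ i, 0 < a i) :
    IsInnerOfSignature r s (diagForm fun i => signs h i * a i) := by
  set e := finSumFinEquiv.trans (finCongr h) with he
  -- The standard basis, normalised by `1 / √(a i)`, turns the entries into signs.
  let b : Module.Basis (Fin n) ℝ (Euc n) := (EuclideanSpace.basisFun (Fin n) ℝ).toBasis.unitsSMul
    fun i => Units.mk0 ((√(a i))⁻¹) (inv_ne_zero (Real.sqrt_pos.2 (ha i)).ne')
  have hb : ∀ i, b i = (√(a i))⁻¹ • stdVec i := by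
    intro i
    simp [b, stdVec, Module.Basis.unitsSMul_apply, Units.smul_def]
  refine ⟨b.reindex e.symm, fun i j => ?_⟩
  simp only [Module.Basis.reindex_apply, Equiv.symm_symm, hb, map_smul, LinearMap.smul_apply,
    diagForm_stdVec, smul_eq_mul, EmbeddingLike.apply_eq_iff_eq]
  by_cases hij : i = j
  · subst hij
    have h1 : signs h (e i) = Sum.elim (fun _ => (-1 : ℝ)) (fun _ => 1) i := by
      simp [signs, ← he]
    have h2 : √(a (e i)) * √(a (e i)) = a (e i) := Real.mul_self_sqrt (ha _).le
    have h3 : √(a (e i)) ≠ 0 := (Real.sqrt_pos.2 (ha _)).ne'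
    simp only [if_true, h1]
    field_simp
    rw [sq, h2, mul_comm]
  · simp [hij]

lemma diagForm_signs_ne_zero (h : r + s = n) (hn : 0 < n) (a : Fin n → ℝ) (ha : ∀ i, 0 < a i) :
    diagForm (fun i => signs h i * a i) ≠ 0 := by
  intro h0
  have h1 := diagForm_stdVec (fun i => signs h i * a i) ⟨0, hn⟩ ⟨0, hn⟩
  have h2 := signs_mul_self h ⟨0, hn⟩
  simp only [h0, LinearMap.zero_apply, if_true] at h1
  rcases mul_eq_zero.1 h1.symm with h3 | h3
  · rw [h3] at h2; simp at h2
  · exact (ha _).ne' h3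

/-- The field of diagonal forms with entries `d x i`, in the frame of the preferred charts. -/
noncomputable def diagField (M : Mfd n) (d : M.carrier → Fin n → ℝ) : FormField M :=
  fun x => (diagForm (d x) : LinearMap.BilinForm ℝ (Euc n))

lemma diagField_symm (M : Mfd n) (d : M.carrier → Fin n → ℝ) (x : M.carrier)
    (v w : TangentSpace (𝓡 n) x) : diagField M d x v w = diagField M d x w v :=
  diagForm_symm (d x) v w

lemma isMetric_diagField (h : r + s = n) (M : Mfd n) (a : M.carrier → Fin n → ℝ)
    (ha : ∀ x i, 0 < a x i) : IsMetric r s (diagField M fun x i => signs h i * a x i) :=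
  fun x => isInnerOfSignature_diagForm h (a x) (ha x)

lemma diagField_ne_zero (h : r + s = n) (hn : 0 < n) (M : Mfd n) (a : M.carrier → Fin n → ℝ)
    (ha : ∀ x i, 0 < a x i) (x : M.carrier) : diagField M (fun x i => signs h i * a x i) x ≠ 0 :=
  diagForm_signs_ne_zero h hn (a x) (ha x)

lemma comp_diagField (M : Mfd n) (d : M.carrier → Fin n → ℝ) (x₀ : M.carrier) (i j : Fin n)
    (y : Euc n) : comp (diagField M d) x₀ i j y = diagForm (d ((M.chart x₀).symm y))
      (fderiv ℝ (fun z => M.chart ((M.chart x₀).symm y) ((M.chart x₀).symm z)) y (stdVec i))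
      (fderiv ℝ (fun z => M.chart ((M.chart x₀).symm y) ((M.chart x₀).symm z)) y (stdVec j)) :=
  rfl

end DiagonalForms

/-! ### The base configuration: a ball in flat space. -/

section FlatSpace

variable {n : ℕ} {r s : ℕ}

/-- `ℝⁿ` as a manifold. -/
noncomputable def euclideanMfd (n : ℕ) : Mfd n where
  carrier := Euc n

lemma comp_euclideanMfd (d : Fin n → ℝ) (x₀ : (euclideanMfd n).carrier) (i j : Fin n)
    (y : Euc n) :
    comp (diagField (euclideanMfd n) fun _ => d) x₀ i j y = if i = j then d i else 0 := by
  rw [comp_diagField]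
  change diagForm d (fderiv ℝ (fun z : Euc n => z) y (stdVec i))
    (fderiv ℝ (fun z : Euc n => z) y (stdVec j)) = _
  rw [fderiv_fun_id]
  exact diagForm_stdVec d i j

/-- The unit ball in the flat space of signature `(r, s)`. -/
noncomputable def flatConfig (p : ℝ≥0∞) (h : r + s = n) : Config n p r s where
  M := euclideanMfd n
  g :=
    { toFun := diagField (euclideanMfd n) fun _ i => signs h i * 1
      symm := diagField_symm _ _
      cont := fun x₀ i j => by
        rw [funext (comp_euclideanMfd _ x₀ i j)]; exact continuousOn_const
      mem := fun x₀ i j => by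
        rw [funext (comp_euclideanMfd _ x₀ i j)]
        exact memW2pLoc_of_contDiffOn ((euclideanMfd n).chart x₀).open_target contDiffOn_const }
  isMetric := isMetric_diagField h _ (fun _ _ => 1) fun _ _ => one_pos
  Ω := (Metric.ball (0 : Euc n) 1 : Set (Euc n))
  isOpen := Metric.isOpen_ball (x := (0 : Euc n))
  precompact := (ProperSpace.isCompact_closedBall (0 : Euc n) 1).of_isClosed_subset isClosed_closure
    (Metric.closure_ball_subset_closedBall (x := (0 : Euc n)))

lemma lagrangian_flatConfig (p : ℝ≥0∞) (h : r + s = n) (x₀ : (euclideanMfd n).carrier) :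
    lagrangian (flatConfig p h).g.toFun x₀
      =ᵐ[volume.restrict ((flatConfig p h).M.chart x₀).target] 0 :=
  lagrangian_ae_eq_zero_of_const _ fun i j y _ => comp_euclideanMfd _ x₀ i j y

end FlatSpace

/-! ### Differentiability of coordinate changes. -/

section Transition

variable {n : ℕ}

lemma differentiableAt_transition (M : Mfd n) (x x₀ : M.carrier) {y : Euc n}
    (hy : y ∈ (M.chart x₀).target) (hx : (M.chart x₀).symm y ∈ (M.chart x).source) :
    DifferentiableAt ℝ (fun z => M.chart x ((M.chart x₀).symm z)) y := by
  have h := (𝓡 n).contDiffOn_extendCoordChange (n := ∞)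
    (IsManifold.chart_mem_maximalAtlas (I := 𝓡 n) (n := ∞) x₀)
    (IsManifold.chart_mem_maximalAtlas (I := 𝓡 n) (n := ∞) x)
  have hs : ((𝓡 n).extendCoordChange (chartAt (Euc n) x₀) (chartAt (Euc n) x)).source
      = (M.chart x₀).target ∩ (M.chart x₀).symm ⁻¹' (M.chart x).source := by
    simp [ModelWithCorners.extendCoordChange, OpenPartialHomeomorph.extend,
      PartialEquiv.trans_source]
  rw [hs] at h
  exact (h.contDiffAt (((M.chart x₀).isOpen_inter_preimage_symm (M.chart x).open_source).mem_nhds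
    ⟨hy, hx⟩)).differentiableAt (by simp)

end Transition

/-! ### Dimension two: shrinking round spheres. -/

section Sphere

open InnerProductSpace

/-- The unit sphere of dimension `n`. -/
abbrev Sph (n : ℕ) : Type := Metric.sphere (0 : Euc (n + 1)) 1

/-- The round sphere of dimension `n`. -/
noncomputable def sphereMfd (n : ℕ) : Mfd n where
  carrier := Sph n
  smooth := IsManifold.of_le (n := ω) (by simp)

variable {n : ℕ}

lemma sphereMfd_target (x₀ : (sphereMfd n).carrier) : ((sphereMfd n).chart x₀).target = univ :=
  let := Fact.mk (@finrank_euclideanSpace_fin ℝ _ (n + 1))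
  stereographic'_target _

/-- The antipode. -/
noncomputable def antipode (x : (sphereMfd n).carrier) : (sphereMfd n).carrier :=
  Neg.neg (α := Sph n) x

lemma sphereMfd_source (x₀ : (sphereMfd n).carrier) :
    ((sphereMfd n).chart x₀).source = {antipode x₀}ᶜ :=
  let := Fact.mk (@finrank_euclideanSpace_fin ℝ _ (n + 1))
  stereographic'_source (Neg.neg (α := Sph n) x₀)

/-- The inverse stereographic projection as a map to the ambient space. -/
noncomputable def sphereEmbedding (x₀ : (sphereMfd n).carrier) (y : Euc n) : Euc (n + 1) :=
  Subtype.val (p := (· ∈ Metric.sphere (0 : Euc (n + 1)) 1)) (((sphereMfd n).chart x₀).symm y)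

/-- Separates the linear isometry `J` onto the hyperplane orthogonal to the pole from the pole `v`
itself, so that derivatives and inner products can be computed by hand. -/
lemma exists_sphereEmbedding_eq (x₀ : (sphereMfd n).carrier) :
    ∃ (J : Euc n →ₗᵢ[ℝ] Euc (n + 1)) (v : Euc (n + 1)),
      ‖v‖ = 1 ∧ (∀ y, ⟪J y, v⟫_ℝ = 0) ∧ sphereEmbedding x₀ = fun y =>
        (4 * (‖y‖ ^ 2 + 4)⁻¹) • J y + (1 - 8 * (‖y‖ ^ 2 + 4)⁻¹) • v := by
  let := Fact.mk (@finrank_euclideanSpace_fin ℝ _ (n + 1))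
  let U := (OrthonormalBasis.fromOrthogonalSpanSingleton (𝕜 := ℝ) n
    (ne_zero_of_mem_unit_sphere (Neg.neg (α := Sph n) x₀))).repr
  refine ⟨(Submodule.subtypeₗᵢ _).comp U.symm.toLinearIsometry,
    Subtype.val (p := (· ∈ Metric.sphere (0 : Euc (n + 1)) 1)) (antipode x₀),
    norm_eq_of_mem_sphere _,
    fun y => ?_, ?_⟩
  · rw [real_inner_comm]
    exact Submodule.mem_orthogonal_singleton_iff_inner_right.1 (U.symm y).2
  · funext y
    refine (stereographic'_symm_apply (Neg.neg (α := Sph n) x₀) y).trans ?_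
    have hn : ‖((U.symm y : _) : Euc (n + 1))‖ = ‖y‖ :=
      U.symm.norm_map y
    simp only [U] at hn
    simp only [hn]
    have h4 : (‖y‖ ^ 2 + 4) ≠ 0 := by positivity
    rw [smul_smul, smul_smul, mul_comm]
    congr 2
    field_simp
    ring

/-- With `q = (‖y‖² + 4)⁻¹`, the terms in `⟪y, a⟫ ⟪y, b⟫` add up to `-64 q³ + 64 q⁴ (‖y‖² + 4) = 0`,
which leaves a multiple of the inner product. -/
lemma sphereEmbedding_hasFDerivAt (x₀ : (sphereMfd n).carrier) (y : Euc n) :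
    ∃ D : Euc n →L[ℝ] Euc (n + 1), HasFDerivAt (sphereEmbedding x₀) D y ∧
      ∀ a b, ⟪D a, D b⟫_ℝ = 16 * ((‖y‖ ^ 2 + 4)⁻¹) ^ 2 * ⟪a, b⟫_ℝ := by
  obtain ⟨J, v, hv, hJv, hE⟩ := exists_sphereEmbedding_eq x₀
  have h4 : (‖y‖ ^ 2 + 4) ≠ 0 := by positivity
  have hq : HasFDerivAt (fun y : Euc n => (‖y‖ ^ 2 + 4)⁻¹)
      ((-((‖y‖ ^ 2 + 4) ^ 2)⁻¹) • ((2 : ℕ) • innerSL ℝ y)) y :=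
    (hasDerivAt_inv h4).comp_hasFDerivAt y ((hasStrictFDerivAt_norm_sq y).hasFDerivAt.add_const 4)
  have hD := ((hq.const_mul 4).smul J.toContinuousLinearMap.hasFDerivAt).add
    (((hq.const_mul 8).const_sub 1).smul_const v)
  rw [hE]
  refine ⟨_, hD, fun a b => ?_⟩
  have hvJ : ∀ y, ⟪v, J y⟫_ℝ = 0 := fun y => by rw [real_inner_comm]; exact hJv y
  have hvv : ⟪v, v⟫_ℝ = 1 := by rw [real_inner_self_eq_norm_sq, hv]; norm_num
  simp only [add_apply, smul_apply,
    ContinuousLinearMap.smulRight_apply, LinearIsometry.coe_toContinuousLinearMap, smul_eq_mul,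
    neg_apply, innerSL_apply_apply,
    inner_add_left, inner_add_right, inner_smul_left, inner_smul_right, hJv, hvJ, hvv,
    J.inner_map_map, real_inner_self_eq_norm_sq, RCLike.conj_to_real, real_inner_comm y]
  field_simp
  ring

/-- The preferred chart at `x` projects from the antipode of `x`. Hence the identification of the
tangent space at `x` with `ℝⁿ` is read off at the origin, where the conformal factor is `1`. -/
lemma sphereMfd_chart_self (x : (sphereMfd n).carrier) : (sphereMfd n).chart x x = (0 : Euc n) := by
  let := Fact.mk (@finrank_euclideanSpace_fin ℝ _ (n + 1))
  exact (congrArg (OrthonormalBasis.fromOrthogonalSpanSingleton (𝕜 := ℝ) n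
    (ne_zero_of_mem_unit_sphere (Neg.neg (α := Sph n) x))).repr
    (stereographic_neg_apply (E := Euc (n + 1)) x)).trans (LinearIsometryEquiv.map_zero _)

/-- Stereographic coordinates are conformal. -/
lemma inner_fderiv_transition_sphereMfd (x₀ : (sphereMfd n).carrier) (y v w : Euc n) :
    ⟪fderiv ℝ (fun z => (sphereMfd n).chart (((sphereMfd n).chart x₀).symm y)
        (((sphereMfd n).chart x₀).symm z)) y v,
      fderiv ℝ (fun z => (sphereMfd n).chart (((sphereMfd n).chart x₀).symm y)
        (((sphereMfd n).chart x₀).symm z)) y w⟫_ℝ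
      = 16 * ((‖y‖ ^ 2 + 4)⁻¹) ^ 2 * ⟪v, w⟫_ℝ := by
  let φ := (sphereMfd n).chart x₀
  let x := φ.symm y
  let φ' := (sphereMfd n).chart x
  have hy : y ∈ φ.target := (sphereMfd_target x₀).symm ▸ mem_univ y
  have hx : φ.symm y ∈ φ'.source := mem_chart_source (Euc n) (φ.symm y)
  obtain ⟨D, hD, hDi⟩ := sphereEmbedding_hasFDerivAt x₀ y
  obtain ⟨D', hD', hDi'⟩ := sphereEmbedding_hasFDerivAt x (0 : Euc n)
  have hτ := (differentiableAt_transition (sphereMfd n) x x₀ hy hx).hasFDerivAt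
  set A := fderiv ℝ (fun z => φ' (φ.symm z)) y with hA
  have h0 : φ' (φ.symm y) = 0 := sphereMfd_chart_self x
  -- Both embeddings parametrise the same sphere, so near `y` one is the other after the change of
  -- coordinates `A`.
  have hcomp : HasFDerivAt (sphereEmbedding x₀) (D'.comp A) y := by
    have h1 : HasFDerivAt (sphereEmbedding x ∘ fun z => φ' (φ.symm z)) (D'.comp A) y := by
      refine HasFDerivAt.comp y ?_ hτ
      change HasFDerivAt _ _ (φ' (φ.symm y))
      rw [h0]
      exact hD'
    refine h1.congr_of_eventuallyEq ?_
    filter_upwards [(φ.isOpen_inter_preimage_symm φ'.open_source).mem_nhds ⟨hy, hx⟩] with z hz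
    change Subtype.val (p := (· ∈ Metric.sphere (0 : Euc (n + 1)) 1)) (φ.symm z)
      = Subtype.val (p := (· ∈ Metric.sphere (0 : Euc (n + 1)) 1)) (φ'.symm (φ' (φ.symm z)))
    rw [φ'.left_inv hz.2]
  have hDA : D = D'.comp A := hD.unique hcomp
  have h1 := hDi v w
  rw [hDA] at h1
  have h2 := hDi' (A v) (A w)
  change ⟪A v, A w⟫_ℝ = _
  simp only [ContinuousLinearMap.comp_apply] at h1
  rw [h1] at h2
  -- The conformal factor at the origin is `16 / 4² = 1`: `D'` is isometric, and `A` inherits the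
  -- conformal factor of `D`.
  norm_num at h2
  rw [← h2, inv_pow]

/-- The conformal factor of stereographic coordinates. -/
noncomputable def sphereFactor (y : Euc n) : ℝ := 16 * ((‖y‖ ^ 2 + 4)⁻¹) ^ 2

lemma comp_sphereMfd (c : ℝ) (x₀ : (sphereMfd n).carrier) (i j : Fin n) (y : Euc n) :
    comp (diagField (sphereMfd n) fun _ _ => c) x₀ i j y
      = if i = j then c * sphereFactor y else 0 := by
  have h1 : ∀ v w : Euc n, diagForm (fun _ => c) v w = c * ⟪v, w⟫_ℝ := fun v w => by
    rw [diagForm_apply, PiLp.inner_apply, Finset.mul_sum]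
    exact Finset.sum_congr rfl fun i _ => by simp; ring
  rw [comp_diagField, h1, inner_fderiv_transition_sphereMfd, stdVec, stdVec,
    EuclideanSpace.inner_single_left]
  by_cases hij : i = j <;> simp [hij, sphereFactor]

lemma contDiff_sphereFactor : ContDiff ℝ ∞ (sphereFactor : Euc n → ℝ) := by
  unfold sphereFactor
  have : ∀ y : Euc n, ‖y‖ ^ 2 + 4 ≠ 0 := fun y => by positivity
  exact contDiff_const.mul ((((contDiff_norm_sq ℝ).add contDiff_const).inv this).pow 2)

lemma contDiff_comp_sphereMfd (c : ℝ) (i j : Fin n) :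
    ContDiff ℝ ∞ fun y : Euc n => if i = j then c * sphereFactor y else 0 := by
  split_ifs
  · exact contDiff_const.mul contDiff_sphereFactor
  · exact contDiff_const

/-- Multiples of the round metric. -/
noncomputable def roundField (n : ℕ) (p : ℝ≥0∞) (c : ℝ) : SobolevField n p (sphereMfd n) where
  toFun := diagField (sphereMfd n) fun _ _ => c
  symm := diagField_symm _ _
  cont x₀ i j := by
    rw [funext (comp_sphereMfd c x₀ i j)]
    exact (contDiff_comp_sphereMfd c i j).continuous.continuousOn
  mem x₀ i j := by
    rw [funext (comp_sphereMfd c x₀ i j)]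
    exact memW2pLoc_of_contDiffOn ((sphereMfd n).chart x₀).open_target
      (contDiff_comp_sphereMfd c i j).contDiffOn

lemma hasFDerivAt_norm_sq_add_inv_pow (m : ℕ) (y : Euc n) :
    HasFDerivAt (fun y : Euc n => ((‖y‖ ^ 2 + 4)⁻¹) ^ m)
      ((-(2 * (m : ℝ) * ((‖y‖ ^ 2 + 4)⁻¹) ^ (m + 1)) : ℝ) • innerSL ℝ y) y := by
  have h4 : (‖y‖ ^ 2 + 4) ≠ 0 := by positivity
  have hq : HasFDerivAt (fun y : Euc n => (‖y‖ ^ 2 + 4)⁻¹)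
      ((-((‖y‖ ^ 2 + 4) ^ 2)⁻¹) • ((2 : ℕ) • innerSL ℝ y)) y :=
    (hasDerivAt_inv h4).comp_hasFDerivAt y ((hasStrictFDerivAt_norm_sq y).hasFDerivAt.add_const 4)
  refine (hq.pow m).congr_fderiv ?_
  ext v
  rcases m with _ | m
  · simp
  · simp
    field_simp
    ring

lemma inner_stdVec (y : Euc n) (k : Fin n) : ⟪y, stdVec k⟫_ℝ = y k := by
  rw [stdVec, EuclideanSpace.inner_single_right]; simp

lemma fderiv_sphereFactor (c : ℝ) (k : Fin n) (y : Euc n) :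
    fderiv ℝ (fun y => c * sphereFactor y) y (stdVec k)
      = c * (-64 * ((‖y‖ ^ 2 + 4)⁻¹) ^ 3 * y k) := by
  have := (((hasFDerivAt_norm_sq_add_inv_pow 2 y).const_mul 16).const_mul c).fderiv
  unfold sphereFactor
  rw [this]
  simp only [smul_apply, smul_eq_mul, innerSL_apply_apply, inner_stdVec, Nat.cast_ofNat]
  ring

lemma fderiv_fderiv_sphereFactor (c : ℝ) (k l : Fin n) (y : Euc n) :
    fderiv ℝ (fun z => fderiv ℝ (fun y => c * sphereFactor y) z (stdVec l)) y (stdVec k)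
      = c * (384 * ((‖y‖ ^ 2 + 4)⁻¹) ^ 4 * y k * y l
        - 64 * ((‖y‖ ^ 2 + 4)⁻¹) ^ 3 * if k = l then 1 else 0) := by
  simp only [fderiv_sphereFactor]
  have hl : HasFDerivAt (fun z : Euc n => z l) (EuclideanSpace.proj l : Euc n →L[ℝ] ℝ) y :=
    (EuclideanSpace.proj l : Euc n →L[ℝ] ℝ).hasFDerivAt
  have := ((((hasFDerivAt_norm_sq_add_inv_pow 3 y).const_mul (-64)).mul hl).const_mul c).fderiv
  refine (congrArg (fun A : Euc n →L[ℝ] ℝ => A (stdVec k)) this).trans ?_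
  have hp : (EuclideanSpace.proj l : Euc n →L[ℝ] ℝ) (stdVec k) = if k = l then 1 else 0 := by
    simp [stdVec, eq_comm]
  simp only [smul_apply, add_apply, smul_eq_mul, innerSL_apply_apply, inner_stdVec,
    Nat.cast_ofNat, hp]
  ring

/-- The scalar curvature of a conformally flat surface. -/
lemma scalarCurvature_conformal (g : ℝ) (hg : g ≠ 0) (a : Fin 2 → ℝ) (b : Fin 2 → Fin 2 → ℝ) :
    scalarCurvature (Matrix.of fun i j : Fin 2 => if i = j then g else 0)
      (fun k i j => if i = j then a k else 0) (fun k l i j => if i = j then b k l else 0)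
      = -(b 0 0 + b 1 1) / g ^ 2 + (a 0 ^ 2 + a 1 ^ 2) / g ^ 3 := by
  have hinv : (Matrix.of fun i j : Fin 2 => if i = j then g else 0)⁻¹
      = Matrix.of fun i j : Fin 2 => if i = j then g⁻¹ else 0 := by
    apply Matrix.inv_eq_right_inv
    ext i j
    fin_cases i <;> fin_cases j <;> simp [Matrix.mul_apply, hg]
  simp only [scalarCurvature, hinv]
  simp [Fin.sum_univ_two]
  field_simp
  ring

/-- The unit sphere has scalar curvature `2`. The factor `σ * lam` divides the curvature by `σ *
lam` and multiplies the area density by `lam`, so only the sign `σ` survives. -/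
lemma lagrangian_roundField (p : ℝ≥0∞) (σ lam : ℝ) (hσ : σ * σ = 1) (hl : 0 < lam)
    (x₀ : (sphereMfd 2).carrier) : lagrangian (roundField 2 p (σ * lam)).toFun x₀
      =ᵐ[volume.restrict ((sphereMfd 2).chart x₀).target]
        fun y => σ * (32 * ((‖y‖ ^ 2 + 4)⁻¹) ^ 2) := by
  refine (lagrangian_ae_eq
    (fun i j (y : Euc 2) => if i = j then (σ * lam) * sphereFactor y else 0)
    (fun i j => (contDiff_comp_sphereMfd (σ * lam) i j).contDiffOn)
    (fun i j y _ => comp_sphereMfd (σ * lam) x₀ i j y)).trans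
    (Filter.Eventually.of_forall fun y => ?_)
  have hσ0 : σ ≠ 0 := by rintro rfl; simp at hσ
  have hq : (0 : ℝ) < (‖y‖ ^ 2 + 4)⁻¹ := by positivity
  have hρ : 0 < sphereFactor y := by unfold sphereFactor; positivity
  have e1 : ∀ k i j : Fin 2, fderiv ℝ (fun y : Euc 2 =>
      if i = j then (σ * lam) * sphereFactor y else 0) y (stdVec k)
      = if i = j then σ * lam * (-64 * ((‖y‖ ^ 2 + 4)⁻¹) ^ 3 * y k) else 0 := by
    intro k i j
    split_ifs
    · exact fderiv_sphereFactor _ k y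
    · simp
  have e2 : ∀ k l i j : Fin 2, fderiv ℝ (fun z => fderiv ℝ (fun y : Euc 2 =>
      if i = j then (σ * lam) * sphereFactor y else 0) z (stdVec l)) y (stdVec k)
      = if i = j then σ * lam * (384 * ((‖y‖ ^ 2 + 4)⁻¹) ^ 4 * y k * y l
        - 64 * ((‖y‖ ^ 2 + 4)⁻¹) ^ 3 * if k = l then 1 else 0) else 0 := by
    intro k l i j
    split_ifs with h1 h2
    · simpa [h2] using fderiv_fderiv_sphereFactor (σ * lam) k l y
    · simpa [h2] using fderiv_fderiv_sphereFactor (σ * lam) k l y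
    · simp
  simp only [e1, e2]
  have hg : σ * lam * sphereFactor y ≠ 0 := mul_ne_zero (mul_ne_zero hσ0 hl.ne') hρ.ne'
  rw [scalarCurvature_conformal _ hg (fun k => σ * lam * (-64 * ((‖y‖ ^ 2 + 4)⁻¹) ^ 3 * y k))
    (fun k l => σ * lam * (384 * ((‖y‖ ^ 2 + 4)⁻¹) ^ 4 * y k * y l
        - 64 * ((‖y‖ ^ 2 + 4)⁻¹) ^ 3 * if k = l then 1 else 0))]
  have hdet : √|(Matrix.of fun i j : Fin 2 =>
      if i = j then σ * lam * sphereFactor y else 0).det| = lam * sphereFactor y := by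
    rw [Matrix.det_fin_two]
    simp only [Matrix.of_apply, if_true]
    rw [show (σ * lam * sphereFactor y * (σ * lam * sphereFactor y)
      - (if (0 : Fin 2) = 1 then σ * lam * sphereFactor y else 0)
        * if (1 : Fin 2) = 0 then σ * lam * sphereFactor y else 0)
      = (lam * sphereFactor y) ^ 2 from by
        simp; linear_combination (lam * sphereFactor y) ^ 2 * hσ]
    rw [abs_of_nonneg (sq_nonneg _), Real.sqrt_sq (by positivity)]
  rw [hdet]
  have hn : ‖y‖ ^ 2 = y 0 ^ 2 + y 1 ^ 2 := by
    rw [EuclideanSpace.norm_sq_eq]; simp [Fin.sum_univ_two]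
  have hy : y 0 ^ 2 = ‖y‖ ^ 2 - y 1 ^ 2 := by rw [hn]; ring
  have hσ2 : σ ^ 2 = 1 := by rw [sq, hσ]
  unfold sphereFactor
  have h4 : (‖y‖ ^ 2 + 4) ≠ 0 := by positivity
  simp only [if_true]
  field_simp
  rw [hσ2, hy]
  ring

/-- The domain of a chart omits one point, which is seen at most once in another chart; points are
null sets as `n > 0`. -/
lemma sphereMfd_chart_full (hn : 0 < n) (x x₀ : (sphereMfd n).carrier) :
    ∀ᵐ y ∂(volume.restrict ((sphereMfd n).chart x₀).target),
      ((sphereMfd n).chart x₀).symm y ∈ ((sphereMfd n).chart x).source := by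
  refine ae_restrict_of_ae ?_
  have : Nonempty (Fin n) := ⟨⟨0, hn⟩⟩
  have hs : {y : Euc n | ((sphereMfd n).chart x₀).symm y
      ∉ ((sphereMfd n).chart x).source}.Subsingleton := by
    intro y hy z hz
    have hmem : ∀ w : Euc n, w ∈ ((sphereMfd n).chart x₀).target := fun w => by
      rw [sphereMfd_target]; trivial
    have h1 : ∀ w : Euc n, ((sphereMfd n).chart x₀).symm w ∉ ((sphereMfd n).chart x).source →
        ((sphereMfd n).chart x₀).symm w = antipode x := by
      intro w hw
      rw [sphereMfd_source] at hw
      exact not_not.1 hw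
    have h2 := (h1 y hy).trans (h1 z hz).symm
    exact ((sphereMfd n).chart x₀).symm.injOn (hmem y) (hmem z) h2
  exact hs.measure_zero _

lemma integral_sphere_pos : 0 < ∫ y : Euc 2, 32 * ((‖y‖ ^ 2 + 4)⁻¹) ^ 2 := by
  have hc : Continuous fun y : Euc 2 => 32 * ((‖y‖ ^ 2 + 4)⁻¹) ^ 2 := by
    have : ∀ y : Euc 2, ‖y‖ ^ 2 + 4 ≠ 0 := fun y => by positivity
    fun_prop (disch := exact this _)
  have hi : Integrable fun y : Euc 2 => 32 * ((‖y‖ ^ 2 + 4)⁻¹) ^ 2 := by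
    -- Domination by `32 (1 + ‖y‖²)⁻²`, which is integrable because the decay exponent `4` exceeds
    -- the dimension `2`.
    have h := (integrable_rpow_neg_one_add_norm_sq (E := Euc 2) (μ := volume) (r := 4)
      (by simp; norm_num)).const_mul 32
    refine h.mono' hc.aestronglyMeasurable (Filter.Eventually.of_forall fun y => ?_)
    rw [Real.norm_of_nonneg (by positivity)]
    have : (1 + ‖y‖ ^ 2) ^ (-4 / 2 : ℝ) = ((1 + ‖y‖ ^ 2)⁻¹) ^ 2 := by
      rw [show (-4 / 2 : ℝ) = -(2 : ℕ) by norm_num, Real.rpow_neg (by positivity),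
        Real.rpow_natCast, inv_pow]
    rw [this]
    gcongr 32 * ?_ ^ 2
    exact inv_anti₀ (by positivity) (by linarith)
  rw [integral_pos_iff_support_of_nonneg (fun y => by positivity) hi]
  have : Function.support (fun y : Euc 2 => 32 * ((‖y‖ ^ 2 + 4)⁻¹) ^ 2) = univ :=
    eq_univ_of_forall fun y => by
      have : 0 < 32 * ((‖y‖ ^ 2 + 4)⁻¹) ^ 2 := by positivity
      exact this.ne'
  rw [this]
  exact isOpen_univ.measure_pos volume univ_nonempty

theorem not_continuous_einsteinHilbert_two {r s : ℕ} (hrs : r + s = 2) (h11 : ¬(r = 1 ∧ s = 1))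
    (p : ℝ≥0∞) (hp : 1 ≤ p) :
    ¬ Continuous[tau₀ 2 p r s, inferInstance] (einsteinHilbert : Config 2 p r s → ℝ) := by
  -- Since `r + s = 2` and `(r, s) ≠ (1, 1)`, one of `r` and `s` vanishes and all signs agree.
  obtain ⟨σ, hσ⟩ : ∃ σ : ℝ, ∀ i, signs hrs i = σ := by
    refine ⟨if r = 0 then 1 else -1, fun i => ?_⟩
    unfold signs
    rcases (finSumFinEquiv.trans (finCongr hrs)).symm i with a | a
    · have := a.pos
      rw [if_neg (by omega)]
      rfl
    · have := a.pos
      rw [if_pos (by omega)]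
      rfl
  have hσ1 : σ * σ = 1 := by rw [← hσ 0]; exact signs_mul_self hrs 0
  have : CompactSpace (sphereMfd 2).carrier := inferInstanceAs (CompactSpace (Sph 2))
  have : Nonempty (sphereMfd 2).carrier :=
    ⟨(⟨EuclideanSpace.single 0 1, by simp⟩ : Sph 2)⟩
  have hpos : ∀ m : ℕ, (0 : ℝ) < 1 / ((m : ℝ) + 1) := fun m => by positivity
  have heq : ∀ m : ℕ, (roundField 2 p (σ * (1 / ((m : ℝ) + 1)))).toFun
      = diagField (sphereMfd 2) fun _ i => signs hrs i * (1 / ((m : ℝ) + 1)) := fun m => by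
    simp only [hσ, roundField]
  refine not_continuous_einsteinHilbert (flatConfig p hrs) (lagrangian_flatConfig p hrs)
    (sphereMfd 2) (fun m => roundField 2 p (σ * (1 / ((m : ℝ) + 1)))) (fun m => ?_)
    (fun m x => ?_) ?_ (sphereMfd_chart_full two_pos)
    (σ * ∫ y : Euc 2, 32 * ((‖y‖ ^ 2 + 4)⁻¹) ^ 2) ?_ fun m x₀ => ?_
  · rw [heq]
    exact isMetric_diagField hrs _ _ fun _ _ => hpos m
  · rw [heq]
    exact diagField_ne_zero hrs two_pos _ _ (fun _ _ => hpos m) x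
  · refine tendsto_of_comp_eq_mul hp (roundField 2 p σ) _ _ (fun m _ _ => 1 / ((m : ℝ) + 1))
      (fun _ _ => tendsto_one_div_add_atTop_nhds_zero_nat) (fun m x₀ i j y _ => ?_) fun _ => rfl
    refine (comp_sphereMfd _ x₀ i j y).trans ?_
    refine Eq.trans ?_ (congrArg _ (comp_sphereMfd σ x₀ i j y).symm)
    split_ifs <;> ring
  · refine mul_ne_zero ?_ integral_sphere_pos.ne'
    rintro rfl
    simp at hσ1
  · rw [integral_congr_ae (lagrangian_roundField p σ _ hσ1 (hpos m) x₀), sphereMfd_target,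
      Measure.restrict_univ, integral_const_mul]

end Sphere

/-! ### The flat torus, with charts given by unit cubes. -/

section Torus

variable {n : ℕ}

/-- The chart of the torus that inverts the projection on the unit cube with corner `a`. -/
noncomputable def torusChart (a : Fin n → ℝ) :
    OpenPartialHomeomorph (Fin n → UnitAddCircle) (Euc n) :=
  (OpenPartialHomeomorph.pi fun i =>
    (AddCircle.openPartialHomeomorphCoe (1 : ℝ) (a i)).symm).transHomeomorph
      (EuclideanSpace.equiv (Fin n) ℝ).symm.toHomeomorph

lemma torusChart_symm (a : Fin n → ℝ) (y : Euc n) :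
    (torusChart a).symm y = fun i => (y i : UnitAddCircle) := rfl

lemma mem_torusChart_source (a : Fin n → ℝ) (θ : Fin n → UnitAddCircle) :
    θ ∈ (torusChart a).source ↔ ∀ i, θ i ≠ (a i : UnitAddCircle) := by
  simp [torusChart]

lemma torusChart_target (a : Fin n → ℝ) :
    (torusChart a).target = WithLp.ofLp ⁻¹' (univ.pi fun i => Ioo (a i) (a i + 1)) := rfl

/-- The changes of coordinates of the torus are locally translations. -/
lemma torusChart_eventually_eq (a : Fin n → ℝ) (y : Euc n)
    (hy : (fun i => (y i : UnitAddCircle)) ∈ (torusChart a).source) :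
    ∃ k : Euc n, (fun z : Euc n => torusChart a fun i => (z i : UnitAddCircle))
      =ᶠ[𝓝 y] fun z => z + k := by
  set w := torusChart a fun i => (y i : UnitAddCircle) with hw
  have hwt : w ∈ (torusChart a).target := (torusChart a).map_source hy
  have hwy : (fun i => (w i : UnitAddCircle)) = fun i => (y i : UnitAddCircle) :=
    (torusChart a).left_inv hy
  -- `w` and `y` have the same projection to the torus, so translation by `w - y` does not change
  -- the projection; near `y` it stays in the cube of the chart.
  refine ⟨w - y, ?_⟩
  have hc : ContinuousAt (fun z : Euc n => z + (w - y)) y := by fun_prop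
  have hmem : ∀ᶠ z in 𝓝 y, z + (w - y) ∈ (torusChart a).target :=
    hc.eventually_mem ((torusChart a).open_target.mem_nhds (by simpa using hwt))
  filter_upwards [hmem] with z hz
  have h1 : (fun i => (z i : UnitAddCircle)) = (torusChart a).symm (z + (w - y)) := by
    rw [torusChart_symm]
    funext i
    have := congrFun hwy i
    simp only at this
    simp [this]
  rw [h1, (torusChart a).right_inv hz]

/-- A point of `ℝⁿ` whose projection has no coordinate in common with `θ`. -/
noncomputable def torusCorner (θ : Fin n → UnitAddCircle) (i : Fin n) : ℝ :=
  (AddCircle.equivIco 1 0 (θ i) : ℝ) - 1 / 2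

lemma mem_source_torusCorner (θ : Fin n → UnitAddCircle) :
    θ ∈ (torusChart (torusCorner θ)).source := by
  rw [mem_torusChart_source]
  intro i h
  have h1 : ((AddCircle.equivIco 1 0 (θ i) : ℝ) : UnitAddCircle) = θ i :=
    (AddCircle.equivIco (1 : ℝ) 0).symm_apply_apply (θ i)
  rw [torusCorner, AddCircle.coe_sub, h1, eq_comm, sub_eq_self,
    AddCircle.coe_eq_zero_iff_of_mem_Ico ⟨by norm_num, by norm_num⟩] at h
  norm_num at h

/-- The atlas of the torus. -/
@[reducible] noncomputable def torusChartedSpace (n : ℕ) :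
    ChartedSpace (Euc n) (Fin n → UnitAddCircle) where
  atlas := range torusChart
  chartAt θ := torusChart (torusCorner θ)
  mem_chart_source := mem_source_torusCorner
  chart_mem_atlas _ := mem_range_self _

/-- The torus of dimension `n`. -/
noncomputable def torusMfd (n : ℕ) : Mfd n :=
  letI := torusChartedSpace n
  { carrier := Fin n → UnitAddCircle
    smooth := by
      refine isManifold_of_contDiffOn (𝓡 n) ∞ _ ?_
      rintro _ _ ⟨a, rfl⟩ ⟨b, rfl⟩ y hy
      obtain ⟨k, hk⟩ := torusChart_eventually_eq b y hy.1.2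
      exact ((contDiff_id.add contDiff_const).contDiffAt.congr_of_eventuallyEq
        hk).contDiffWithinAt }

instance : CompactSpace (torusMfd n).carrier :=
  inferInstanceAs (CompactSpace (Fin n → UnitAddCircle))

instance : Nonempty (torusMfd n).carrier := inferInstanceAs (Nonempty (Fin n → UnitAddCircle))

/-- The projection of the universal cover. -/
noncomputable def torusProj (y : Euc n) : (torusMfd n).carrier :=
  fun i => ((y i : ℝ) : UnitAddCircle)

/-- Coordinate changes have the identity as derivative, so the components in every chart are the
entries lifted to `ℝⁿ`. No condition on `y` is needed, as the inverse of every chart is the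
projection on all of `ℝⁿ`. -/
lemma comp_torusMfd (d : (torusMfd n).carrier → Fin n → ℝ) (x₀ : (torusMfd n).carrier)
    (i j : Fin n) (y : Euc n) :
    comp (diagField (torusMfd n) d) x₀ i j y = if i = j then d (torusProj y) i else 0 := by
  have hA : fderiv ℝ (fun z => (torusMfd n).chart (((torusMfd n).chart x₀).symm y)
      (((torusMfd n).chart x₀).symm z)) y = ContinuousLinearMap.id ℝ (Euc n) := by
    obtain ⟨k, hk⟩ := torusChart_eventually_eq (torusCorner (torusProj y)) y
      (mem_source_torusCorner _)
    refine (Filter.EventuallyEq.fderiv_eq hk).trans ?_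
    rw [fderiv_add_const, fderiv_fun_id]
  rw [comp_diagField, hA]
  exact diagForm_stdVec _ i j

lemma torusMfd_target (x₀ : (torusMfd n).carrier) : ∃ a : Fin n → ℝ,
    ((torusMfd n).chart x₀).target = WithLp.ofLp ⁻¹' (univ.pi fun i => Ioo (a i) (a i + 1)) :=
  ⟨_, torusChart_target _⟩

/-- The points outside the domain of a chart have some coordinate in `aᵢ + ℤ`, with `a` the corner
of the cube: countably many hyperplanes. -/
lemma torusMfd_chart_full (x x₀ : (torusMfd n).carrier) :
    ∀ᵐ y ∂(volume.restrict ((torusMfd n).chart x₀).target),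
      ((torusMfd n).chart x₀).symm y ∈ ((torusMfd n).chart x).source := by
  refine ae_restrict_of_ae ?_
  have h1 : ∀ c : ℝ, ∀ᵐ t : ℝ, (t : UnitAddCircle) ≠ c := by
    intro c
    have hs : {t : ℝ | ¬ (t : UnitAddCircle) ≠ c} ⊆ range fun k : ℤ => c + k := by
      intro t ht
      have ht' : (t : UnitAddCircle) = c := not_not.1 ht
      rw [← sub_eq_zero, ← AddCircle.coe_sub, AddCircle.coe_eq_zero_iff] at ht'
      obtain ⟨k, hk⟩ := ht'
      refine ⟨k, ?_⟩
      simp only [zsmul_eq_mul, mul_one] at hk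
      simp only [hk]
      ring
    exact ((countable_range _).mono hs).measure_zero _
  have h2 : ∀ i, ∀ᵐ y : Euc n, (y i : UnitAddCircle) ≠ (torusCorner x i : ℝ) := fun i =>
    ((Measure.quasiMeasurePreserving_eval (fun _ : Fin n => (volume : Measure ℝ)) i).comp
      (PiLp.volume_preserving_ofLp (Fin n)).quasiMeasurePreserving).ae (h1 _)
  filter_upwards [ae_all_iff.2 h2] with y hy
  exact (mem_torusChart_source _ _).2 hy

/-- Integration over a unit cube of a function of one coordinate. -/
lemma setIntegral_cube (a : Fin n → ℝ) (i : Fin n) (W : ℝ → ℝ) (hW : Continuous W) :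
    ∫ y : Euc n in WithLp.ofLp ⁻¹' (univ.pi fun i => Ioo (a i) (a i + 1)), W (y i)
      = ∫ t in a i..a i + 1, W t := by
  have hprob : ∀ i, IsProbabilityMeasure ((volume : Measure ℝ).restrict (Ioo (a i) (a i + 1))) :=
    fun i => ⟨by simp⟩
  have e1 := (PiLp.volume_preserving_ofLp (Fin n)).setIntegral_preimage_emb
    (MeasurableEquiv.toLp 2 (Fin n → ℝ)).symm.measurableEmbedding (fun x => W (x i))
    (univ.pi fun i => Ioo (a i) (a i + 1))
  refine e1.trans ?_
  rw [volume_pi, Measure.restrict_pi_pi]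
  -- The measure on the cube is a product of probability measures, whose marginal is Lebesgue
  -- measure on one side.
  have e2 := (measurePreserving_eval
    (fun j => (volume : Measure ℝ).restrict (Ioo (a j) (a j + 1))) i)
  rw [intervalIntegral.integral_of_le (by linarith), integral_Ioc_eq_integral_Ioo, ← e2.map_eq,
    integral_map e2.measurable.aemeasurable hW.aestronglyMeasurable]

end Torus

/-! ### Scalar curvature of diagonal metrics of one variable. -/

section DiagonalCurvature

/-- The scalar curvature of a diagonal metric depending on the coordinate `0` only, and whose
component `0` is constant. -/
lemma scalarCurvature_diagonal {m : ℕ} (d d1 d2 : Fin (m + 1) → ℝ) (hd : ∀ i, d i ≠ 0)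
    (h1 : d1 0 = 0) (h2 : d2 0 = 0) :
    scalarCurvature (Matrix.of fun i j => if i = j then d i else 0)
      (fun k i j => if i = j then if k = 0 then d1 i else 0 else 0)
      (fun k l i j => if i = j then if k = 0 ∧ l = 0 then d2 i else 0 else 0)
      = (d 0)⁻¹ * (-∑ i, (d i)⁻¹ * d2 i + 3 / 4 * ∑ i, ((d i)⁻¹ * d1 i) ^ 2
        - 1 / 4 * (∑ i, (d i)⁻¹ * d1 i) ^ 2) := by
  have hinv : (Matrix.of fun i j : Fin (m + 1) => if i = j then d i else 0)⁻¹
      = Matrix.of fun i j : Fin (m + 1) => if i = j then (d i)⁻¹ else 0 := by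
    apply Matrix.inv_eq_right_inv
    ext i j
    simp only [Matrix.mul_apply, Matrix.of_apply, ite_mul, zero_mul, Finset.sum_ite_eq,
      Finset.mem_univ, if_true, Matrix.one_apply]
    by_cases hij : i = j <;> simp [hij, hd]
  set Γ : Fin (m + 1) → Fin (m + 1) → Fin (m + 1) → ℝ := fun e a b => 1 / 2 * ((d e)⁻¹ *
    ((if e = b then if a = 0 then d1 e else 0 else 0)
      + (if e = a then if b = 0 then d1 e else 0 else 0)
      - (if a = b then if e = 0 then d1 a else 0 else 0))) with hΓ
  -- Two of the three terms of `Γ` can be present together only for `e = a = b = 0`, where `d1 0 =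
  -- 0`; so the square has no mixed terms.
  have hsq : ∀ e a b, Γ e a b * Γ e a b = 1 / 4 * ((d e)⁻¹ ^ 2 *
      ((if e = b then if a = 0 then d1 e ^ 2 else 0 else 0)
      + (if e = a then if b = 0 then d1 e ^ 2 else 0 else 0)
      + (if e = 0 then if a = b then d1 a ^ 2 else 0 else 0))) := by
    intro e a b
    simp only [hΓ]
    split_ifs <;> subst_vars <;> first | contradiction | ring1 | (simp only [h1]; ring1)
  have hprod : ∀ e a b, Γ e a a * Γ e b b = 1 / 4 * ((d e)⁻¹ ^ 2 *
      (if e = 0 then d1 a * d1 b else 0)) := by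
    intro e a b
    simp only [hΓ]
    split_ifs <;> subst_vars <;> first | contradiction | ring1 | (simp only [h1]; ring1)
  have hsymm : ∀ e a b, Γ e b a = Γ e a b := by
    intro e a b
    simp only [hΓ]
    split_ifs <;> subst_vars <;> first | contradiction | ring
  -- Only `c = a` and `d = b` survive the contraction with the diagonal inverse metric, so the
  -- quadratic part of the curvature is needed for these indices only.
  have hR : ∀ a b, (∑ e, ∑ f, (Matrix.of fun i j : Fin (m + 1) => if i = j then d i else 0) e f *
      (Γ e b a * Γ f a b - Γ e b b * Γ f a a)) =
      1 / 4 * ((if a = 0 then (d b)⁻¹ * d1 b ^ 2 else 0)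
        + (if b = 0 then (d a)⁻¹ * d1 a ^ 2 else 0)
        + (if a = b then (d 0)⁻¹ * d1 a ^ 2 else 0) - (d 0)⁻¹ * (d1 a * d1 b)) := by
    intro a b
    have e1 : ∀ e, (∑ f, (Matrix.of fun i j : Fin (m + 1) => if i = j then d i else 0) e f *
        (Γ e b a * Γ f a b - Γ e b b * Γ f a a)) = 1 / 4 * ((d e)⁻¹ *
      ((if e = b then if a = 0 then d1 e ^ 2 else 0 else 0)
      + (if e = a then if b = 0 then d1 e ^ 2 else 0 else 0)
      + (if e = 0 then if a = b then d1 a ^ 2 else 0 else 0)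
      - (if e = 0 then d1 a * d1 b else 0))) := by
      intro e
      simp only [Matrix.of_apply, ite_mul, zero_mul, Finset.sum_ite_eq, Finset.mem_univ, if_true]
      rw [hsymm e a b, hsq, mul_comm (Γ e b b), hprod]
      have := hd e
      field_simp
    simp only [e1]
    rw [← Finset.mul_sum]
    simp only [mul_sub, mul_add, Finset.sum_sub_distrib, Finset.sum_add_distrib, mul_ite, mul_zero,
      Finset.sum_ite_eq', Finset.mem_univ, if_true]
  have hG : ∀ e a b : Fin (m + 1), 1 / 2 * ∑ x,
      (Matrix.of fun i j : Fin (m + 1) => if i = j then (d i)⁻¹ else 0) e x *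
      ((if x = b then if a = 0 then d1 x else 0 else 0)
      + (if x = a then if b = 0 then d1 x else 0 else 0)
      - (if a = b then if x = 0 then d1 a else 0 else 0)) = Γ e a b := by
    intro e a b
    simp only [Matrix.of_apply, ite_mul, zero_mul, Finset.sum_ite_eq, Finset.mem_univ, if_true, hΓ]
  simp only [scalarCurvature, hinv, hG]
  have hcol : ∀ (a b : Fin (m + 1)) (X : Fin (m + 1) → Fin (m + 1) → ℝ), (∑ c, ∑ e,
      (Matrix.of fun i j : Fin (m + 1) => if i = j then (d i)⁻¹ else 0) a c *
      (Matrix.of fun i j : Fin (m + 1) => if i = j then (d i)⁻¹ else 0) b e * X c e)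
      = (d a)⁻¹ * (d b)⁻¹ * X a b := by
    intro a b X
    simp only [Matrix.of_apply, ite_mul, zero_mul, mul_ite, mul_zero, Finset.sum_ite_eq,
      Finset.mem_univ, if_true]
  simp only [hcol, hR]
  have hterm : ∀ a b, (d a)⁻¹ * (d b)⁻¹ * (1 / 2 *
      ((((if a = b then if b = 0 ∧ a = 0 then d2 a else 0 else 0)
        + if b = a then if a = 0 ∧ b = 0 then d2 b else 0 else 0)
        - if a = 0 ∧ a = 0 then d2 b else 0)
        - if b = 0 ∧ b = 0 then d2 a else 0)
      + 1 / 4 * ((((if a = 0 then (d b)⁻¹ * d1 b ^ 2 else 0)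
        + if b = 0 then (d a)⁻¹ * d1 a ^ 2 else 0)
        + if a = b then (d 0)⁻¹ * d1 a ^ 2 else 0) - (d 0)⁻¹ * (d1 a * d1 b)))
      = (if a = 0 then (d 0)⁻¹ * (-(1 / 2) * ((d b)⁻¹ * d2 b)
          + 1 / 4 * ((d b)⁻¹ * d1 b) ^ 2) else 0)
        + (if b = 0 then (d 0)⁻¹ * (-(1 / 2) * ((d a)⁻¹ * d2 a)
          + 1 / 4 * ((d a)⁻¹ * d1 a) ^ 2) else 0)
        + (if a = b then (d 0)⁻¹ * (1 / 4 * ((d a)⁻¹ * d1 a) ^ 2) else 0)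
        - (d 0)⁻¹ * (1 / 4 * (((d a)⁻¹ * d1 a) * ((d b)⁻¹ * d1 b))) := by
    intro a b
    clear hcol hR hG hsq hprod hsymm hinv hΓ Γ
    by_cases hab : a = b
    · subst hab
      by_cases ha : a = 0
      · subst ha
        simp only [h1, h2, and_self, if_true]
        ring
      · simp only [ha, and_self, if_true, if_false]
        ring
    · have hba : ¬ b = a := fun h => hab h.symm
      by_cases ha : a = 0
      · subst ha
        simp only [hab, hba, h1, h2, and_self, if_true, if_false]
        ring
      · by_cases hb : b = 0
        · subst hb
          simp only [hab, hba, h1, h2, and_self, if_true, if_false]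
          ring
        · simp only [hab, hba, ha, hb, and_self, if_false]
          ring
  refine (Finset.sum_congr rfl fun a _ => Finset.sum_congr rfl fun b _ => ?_).trans
    ((Finset.sum_congr rfl fun a _ => Finset.sum_congr rfl fun b _ => hterm a b).trans ?_)
  · simp only [if_true]
  · simp only [Finset.sum_sub_distrib, Finset.sum_add_distrib, Finset.sum_ite_eq, Finset.sum_ite_eq',
      Finset.mem_univ, if_true, ← Finset.mul_sum, ← Finset.sum_mul, Finset.sum_ite_irrel,
      Finset.sum_const_zero]
    ring

end DiagonalCurvature

/-! ### Dimension at least three: collapsing warped tori, with `n = q + 3`. -/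

section TorusMetrics

open Real

/-- The warping function of the metrics on the torus. -/
noncomputable def warp (t : ℝ) : ℝ := 2 + cos (2 * π * t)

/-- The derivative of `warp`. -/
noncomputable def warp₁ (t : ℝ) : ℝ := -(2 * π * sin (2 * π * t))

/-- The second derivative of `warp`. -/
noncomputable def warp₂ (t : ℝ) : ℝ := -((2 * π) ^ 2 * cos (2 * π * t))

lemma hasDerivAt_warp (t : ℝ) : HasDerivAt warp (warp₁ t) t := by
  have h := (((hasDerivAt_id t).const_mul (2 * π)).cos).const_add 2
  refine h.congr_deriv ?_
  simp [warp₁]; ring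

lemma hasDerivAt_warp₁ (t : ℝ) : HasDerivAt warp₁ (warp₂ t) t := by
  have h := ((((hasDerivAt_id t).const_mul (2 * π)).sin).const_mul (2 * π)).neg
  refine h.congr_deriv ?_
  simp [warp₂]; ring

lemma warp_pos (t : ℝ) : 0 < warp t := by
  have := neg_one_le_cos (2 * π * t)
  unfold warp
  linarith

lemma contDiff_warp : ContDiff ℝ ∞ warp := by
  unfold warp
  exact contDiff_const.add (contDiff_cos.comp (contDiff_const.mul contDiff_id))

lemma continuous_warp₁ : Continuous warp₁ := by unfold warp₁; fun_prop

lemma continuous_warp₂ : Continuous warp₂ := by unfold warp₂; fun_prop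

lemma periodic_warp : Function.Periodic warp 1 := fun t => by
  simp only [warp, mul_add, mul_one, cos_add_two_pi]

lemma periodic_warp₁ : Function.Periodic warp₁ 1 := fun t => by
  simp only [warp₁, mul_add, mul_one, sin_add_two_pi]

lemma periodic_warp₂ : Function.Periodic warp₂ 1 := fun t => by
  simp only [warp₂, mul_add, mul_one, cos_add_two_pi]

/-- The density of the action of the warped metrics. -/
noncomputable def warpDensity (q : ℕ) (t : ℝ) : ℝ :=
  warp t ^ q * (-(2 * ((q : ℝ) + 2)) * (warp t * warp₂ t)
    - ((q : ℝ) + 2) * ((q : ℝ) + 1) * warp₁ t ^ 2)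

lemma continuous_warpDensity (q : ℕ) : Continuous (warpDensity q) := by
  have h0 := contDiff_warp.continuous
  have h1 := continuous_warp₁
  have h2 := continuous_warp₂
  unfold warpDensity
  fun_prop

lemma integral_warpDensity (q : ℕ) (a : ℝ) :
    ∫ t in a..a + 1, warpDensity q t = ∫ t in (0 : ℝ)..1, warpDensity q t := by
  have hper : Function.Periodic (warpDensity q) 1 := fun t => by
    simp only [warpDensity, periodic_warp t, periodic_warp₁ t, periodic_warp₂ t]
  simpa using hper.intervalIntegral_add_eq a 0

/-- Integration by parts over a period turns `-2 (q+2) w^{q+1} w''` into `2 (q+2)(q+1) w^q w'²`.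
Together with the other term this leaves `(q+2)(q+1) ∫ w^q w'²`. -/
lemma integral_warpDensity_pos (q : ℕ) : 0 < ∫ t in (0 : ℝ)..1, warpDensity q t := by
  have h0 := contDiff_warp.continuous
  have h1 := continuous_warp₁
  have h2 := continuous_warp₂
  -- `A` is the periodic boundary term, whose derivative integrates to zero; `B` is the nonnegative
  -- remainder.
  let A : ℝ → ℝ := fun t => -(2 * ((q : ℝ) + 2)) * (warp t ^ (q + 1) * warp₁ t)
  let A' : ℝ → ℝ := fun t => -(2 * ((q : ℝ) + 2)) *
    (((q : ℝ) + 1) * warp t ^ q * warp₁ t * warp₁ t + warp t ^ (q + 1) * warp₂ t)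
  let B : ℝ → ℝ := fun t => ((q : ℝ) + 2) * ((q : ℝ) + 1) * (warp t ^ q * warp₁ t ^ 2)
  have hA : ∀ t, HasDerivAt A (A' t) t := fun t => by
    have h := (((hasDerivAt_warp t).pow (q + 1)).mul (hasDerivAt_warp₁ t)).const_mul
      (-(2 * ((q : ℝ) + 2)))
    refine h.congr_deriv ?_
    simp [A']
  have hAc : Continuous A' := by simp only [A']; fun_prop
  have hBc : Continuous B := by simp only [B]; fun_prop
  have hAB : ∀ t, warpDensity q t = A' t + B t := fun t => by
    simp only [warpDensity, A', B]; ring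
  have hA0 : ∫ t in (0 : ℝ)..1, A' t = 0 := by
    rw [intervalIntegral.integral_eq_sub_of_hasDerivAt (fun t _ => hA t)
      (hAc.intervalIntegrable _ _)]
    have e1 := periodic_warp 0
    have e2 := periodic_warp₁ 0
    rw [zero_add] at e1 e2
    simp only [A, e1, e2, sub_self]
  simp only [hAB]
  rw [intervalIntegral.integral_add (hAc.intervalIntegrable _ _) (hBc.intervalIntegrable _ _), hA0,
    zero_add]
  refine intervalIntegral.integral_pos one_pos hBc.continuousOn (fun t _ => ?_)
    -- At a quarter of the period the sine in `warp₁` is `1`, so the integrand is positive there.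
    ⟨1 / 4, ⟨by norm_num, by norm_num⟩, ?_⟩
  · have := warp_pos t
    simp only [B]; positivity
  · have hw := warp_pos (1 / 4)
    have h4 : warp₁ (1 / 4) = -(2 * π) := by
      rw [warp₁, show 2 * π * (1 / 4) = π / 2 by ring, sin_pi_div_two, mul_one]
    simp only [B, h4, neg_sq]
    have := pi_pos
    positivity

variable {q r s : ℕ}

/-- The entries of the warped metric, up to signs. -/
noncomputable def warpEntries (N δ : ℝ) (i : Fin (q + 3)) (t : ℝ) : ℝ :=
  if i = 0 then N else δ * warp t ^ 2

lemma contDiff_warpEntries (N δ : ℝ) (i : Fin (q + 3)) : ContDiff ℝ ∞ (warpEntries N δ i) := by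
  unfold warpEntries
  split_ifs
  · exact contDiff_const
  · exact contDiff_const.mul (contDiff_warp.pow 2)

lemma periodic_warpEntries (N δ : ℝ) (i : Fin (q + 3)) :
    Function.Periodic (warpEntries N δ i) 1 := fun t => by
  simp only [warpEntries, periodic_warp t]

lemma warpEntries_pos {N δ : ℝ} (hN : 0 < N) (hδ : 0 < δ) (i : Fin (q + 3)) (t : ℝ) :
    0 < warpEntries N δ i t := by
  have := warp_pos t
  unfold warpEntries
  split_ifs <;> positivity

/-- The entries of the warped metric as functions on the torus. -/
noncomputable def torusEntries (N δ : ℝ) (θ : (torusMfd (q + 3)).carrier) (i : Fin (q + 3)) : ℝ :=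
  (periodic_warpEntries N δ i).lift ((show Fin (q + 3) → UnitAddCircle from θ) 0)

lemma torusEntries_torusProj (N δ : ℝ) (y : Euc (q + 3)) (i : Fin (q + 3)) :
    torusEntries N δ (torusProj y) i = warpEntries N δ i (y 0) := rfl

lemma torusEntries_pos {N δ : ℝ} (hN : 0 < N) (hδ : 0 < δ) (θ : (torusMfd (q + 3)).carrier)
    (i : Fin (q + 3)) : 0 < torusEntries N δ θ i := by
  obtain ⟨t, ht⟩ := QuotientAddGroup.mk_surjective ((show Fin (q + 3) → UnitAddCircle from θ) 0)
  rw [torusEntries, ← ht]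
  exact warpEntries_pos hN hδ i t

lemma comp_torusEntries (h : r + s = q + 3) (N δ : ℝ) (x₀ : (torusMfd (q + 3)).carrier)
    (i j : Fin (q + 3)) (y : Euc (q + 3)) :
    comp (diagField (torusMfd (q + 3)) fun θ i => signs h i * torusEntries N δ θ i) x₀ i j y
      = if i = j then signs h i * warpEntries N δ i (y 0) else 0 := by
  rw [comp_torusMfd, torusEntries_torusProj]

lemma contDiff_comp_torusEntries (h : r + s = q + 3) (N δ : ℝ) (i j : Fin (q + 3)) :
    ContDiff ℝ ∞ fun y : Euc (q + 3) =>
      if i = j then signs h i * warpEntries N δ i (y 0) else 0 := by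
  split_ifs
  · exact contDiff_const.mul ((contDiff_warpEntries N δ i).comp
      (EuclideanSpace.proj (0 : Fin (q + 3)) : Euc (q + 3) →L[ℝ] ℝ).contDiff)
  · exact contDiff_const

/-- The warped metric `± N dt² + ∑ ± δ warp(t)² dxᵢ²` on the torus. -/
noncomputable def torusField (h : r + s = q + 3) (p : ℝ≥0∞) (N δ : ℝ) :
    SobolevField (q + 3) p (torusMfd (q + 3)) where
  toFun := diagField (torusMfd (q + 3)) fun θ i => signs h i * torusEntries N δ θ i
  symm := diagField_symm _ _
  cont x₀ i j := by
    rw [funext (comp_torusEntries h N δ x₀ i j)]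
    exact (contDiff_comp_torusEntries h N δ i j).continuous.continuousOn
  mem x₀ i j := by
    rw [funext (comp_torusEntries h N δ x₀ i j)]
    exact memW2pLoc_of_contDiffOn ((torusMfd (q + 3)).chart x₀).open_target
      (contDiff_comp_torusEntries h N δ i j).contDiffOn

lemma fderiv_comp_coord {n : ℕ} (i k : Fin n) {f : ℝ → ℝ} {f' : ℝ} (y : Euc n)
    (hf : HasDerivAt f f' (y i)) :
    fderiv ℝ (fun z : Euc n => f (z i)) y (stdVec k) = if k = i then f' else 0 := by
  have h := hf.comp_hasFDerivAt y (EuclideanSpace.proj i : Euc n →L[ℝ] ℝ).hasFDerivAt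
  refine (congrArg (fun A : Euc n →L[ℝ] ℝ => A (stdVec k)) h.fderiv).trans ?_
  simp [stdVec, eq_comm]

/-- The first derivatives of the entries of the warped metric. -/
noncomputable def warpEntries₁ (δ : ℝ) (i : Fin (q + 3)) (t : ℝ) : ℝ :=
  if i = 0 then 0 else δ * (2 * warp t * warp₁ t)

/-- The second derivatives of the entries of the warped metric. -/
noncomputable def warpEntries₂ (δ : ℝ) (i : Fin (q + 3)) (t : ℝ) : ℝ :=
  if i = 0 then 0 else δ * (2 * warp₁ t ^ 2 + 2 * warp t * warp₂ t)

lemma hasDerivAt_warpEntries (N δ : ℝ) (i : Fin (q + 3)) (t : ℝ) :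
    HasDerivAt (warpEntries N δ i) (warpEntries₁ δ i t) t := by
  unfold warpEntries warpEntries₁
  split_ifs
  · exact hasDerivAt_const t N
  · refine (((hasDerivAt_warp t).pow 2).const_mul δ).congr_deriv ?_
    norm_num

lemma hasDerivAt_warpEntries₁ (δ : ℝ) (i : Fin (q + 3)) (t : ℝ) :
    HasDerivAt (warpEntries₁ δ i) (warpEntries₂ δ i t) t := by
  unfold warpEntries₁ warpEntries₂
  split_ifs
  · exact hasDerivAt_const t 0
  · refine ((((hasDerivAt_warp t).const_mul 2).mul (hasDerivAt_warp₁ t)).const_mul δ).congr_deriv ?_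
    ring

lemma abs_signs {n : ℕ} (h : r + s = n) (i : Fin n) : |signs h i| = 1 := by
  have h1 := signs_mul_self h i
  rw [← abs_mul_abs_self] at h1
  nlinarith [abs_nonneg (signs h i)]

/-- The curvature is `1 / (± N)` times an expression in the ratios of the derivatives of the entries
to the entries, in which `δ` and the signs of the other directions cancel. The remaining factor `N⁻¹
N^{1/2} δ^{(q+2)/2}` equals `1` for this choice of `N` and `δ`. -/
lemma lagrangian_torusField (h : r + s = q + 3) (p : ℝ≥0∞) {lam : ℝ} (hl : 0 < lam)
    (x₀ : (torusMfd (q + 3)).carrier) :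
    lagrangian (torusField h p ((lam ^ (q + 2)) ^ 2) (lam ^ 2)).toFun x₀
      =ᵐ[volume.restrict ((torusMfd (q + 3)).chart x₀).target]
        fun y => signs h 0 * warpDensity q (y 0) := by
  set N := (lam ^ (q + 2)) ^ 2 with hN
  set δ := lam ^ 2 with hδ
  refine (lagrangian_ae_eq
    (fun i j (y : Euc (q + 3)) => if i = j then signs h i * warpEntries N δ i (y 0) else 0)
    (fun i j => (contDiff_comp_torusEntries h N δ i j).contDiffOn)
    (fun i j y _ => comp_torusEntries h N δ x₀ i j y)).trans
    (Filter.Eventually.of_forall fun y => ?_)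
  have e1 : ∀ (k i j : Fin (q + 3)) (y : Euc (q + 3)), fderiv ℝ (fun y : Euc (q + 3) =>
      if i = j then signs h i * warpEntries N δ i (y 0) else 0) y (stdVec k)
      = if i = j then if k = 0 then signs h i * warpEntries₁ δ i (y 0) else 0 else 0 := by
    intro k i j y
    by_cases hij : i = j
    · simp only [hij, if_true]
      exact fderiv_comp_coord 0 k y ((hasDerivAt_warpEntries N δ j (y 0)).const_mul (signs h j))
    · simp [hij]
  have e2 : ∀ (k l i j : Fin (q + 3)), fderiv ℝ (fun y : Euc (q + 3) =>
      if i = j then if l = 0 then signs h i * warpEntries₁ δ i (y 0) else 0 else 0) y (stdVec k)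
      = if i = j then if k = 0 ∧ l = 0 then signs h i * warpEntries₂ δ i (y 0) else 0 else 0 := by
    intro k l i j
    by_cases hij : i = j
    · by_cases hl : l = 0
      · simp only [hij, hl, if_true, and_true]
        exact fderiv_comp_coord 0 k y ((hasDerivAt_warpEntries₁ δ j (y 0)).const_mul (signs h j))
      · simp [hl]
    · simp [hij]
  simp only [e1, e2]
  have hs0 : ∀ i, signs h i ≠ 0 := fun i h0 => by
    have := signs_mul_self h i
    simp [h0] at this
  have hN0 : 0 < N := by positivity
  have hδ0 : 0 < δ := by positivity
  have hw := warp_pos (y 0)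
  rw [scalarCurvature_diagonal (fun i => signs h i * warpEntries N δ i (y 0))
    (fun i => signs h i * warpEntries₁ δ i (y 0)) (fun i => signs h i * warpEntries₂ δ i (y 0))
    (fun i => mul_ne_zero (hs0 i) (warpEntries_pos hN0 hδ0 i _).ne')
    (by simp [warpEntries₁]) (by simp [warpEntries₂])]
  have hdet : √|(Matrix.of fun i j : Fin (q + 3) =>
      if i = j then signs h i * warpEntries N δ i (y 0) else 0).det|
      = lam ^ (q + 2) * (lam * warp (y 0)) ^ (q + 2) := by
    have hd : (Matrix.of fun i j : Fin (q + 3) =>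
        if i = j then signs h i * warpEntries N δ i (y 0) else 0)
        = Matrix.diagonal fun i => signs h i * warpEntries N δ i (y 0) := by
      ext i j
      simp [Matrix.diagonal_apply]
    rw [hd, Matrix.det_diagonal, Finset.abs_prod, Fin.prod_univ_succ]
    simp only [abs_mul, abs_signs, one_mul, warpEntries, Fin.succ_ne_zero, if_true, if_false,
      Finset.prod_const, Finset.card_univ, Fintype.card_fin, abs_pow, abs_of_pos hw,
      abs_of_pos hN0, abs_of_pos hδ0]
    -- Both `N` and `δ` are written as squares, so the root of the determinant is an explicit
    -- product.
    rw [show N * (δ * warp (y 0) ^ 2) ^ (q + 2)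
      = (lam ^ (q + 2) * (lam * warp (y 0)) ^ (q + 2)) ^ 2 by
        rw [hN, hδ]; ring]
    exact Real.sqrt_sq (by positivity)
  have r1 : ∀ i : Fin (q + 2), (signs h i.succ * warpEntries N δ i.succ (y 0))⁻¹
      * (signs h i.succ * warpEntries₁ δ i.succ (y 0)) = 2 * warp₁ (y 0) / warp (y 0) := by
    intro i
    have := hs0 i.succ
    simp only [warpEntries, warpEntries₁, Fin.succ_ne_zero, if_false]
    field_simp
  have r2 : ∀ i : Fin (q + 2), (signs h i.succ * warpEntries N δ i.succ (y 0))⁻¹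
      * (signs h i.succ * warpEntries₂ δ i.succ (y 0))
      = (2 * warp₁ (y 0) ^ 2 + 2 * warp (y 0) * warp₂ (y 0)) / warp (y 0) ^ 2 := by
    intro i
    have := hs0 i.succ
    simp only [warpEntries, warpEntries₂, Fin.succ_ne_zero, if_false]
    field_simp
  have z1 : warpEntries₁ δ (0 : Fin (q + 3)) (y 0) = 0 := by simp [warpEntries₁]
  have z2 : warpEntries₂ δ (0 : Fin (q + 3)) (y 0) = 0 := by simp [warpEntries₂]
  have z0 : warpEntries N δ (0 : Fin (q + 3)) (y 0) = N := by simp [warpEntries]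
  have hinv : (signs h 0)⁻¹ = signs h 0 := inv_eq_of_mul_eq_one_left (signs_mul_self h 0)
  have S1 : ∑ i, (signs h i * warpEntries N δ i (y 0))⁻¹ * (signs h i * warpEntries₁ δ i (y 0))
      = ((q : ℝ) + 2) * (2 * warp₁ (y 0) / warp (y 0)) := by
    rw [Fin.sum_univ_succ]
    simp only [r1, z1, mul_zero, zero_add, Finset.sum_const, Finset.card_univ, Fintype.card_fin,
      nsmul_eq_mul, Nat.cast_add, Nat.cast_ofNat]
  have S1' : ∑ i, ((signs h i * warpEntries N δ i (y 0))⁻¹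
      * (signs h i * warpEntries₁ δ i (y 0))) ^ 2
      = ((q : ℝ) + 2) * (2 * warp₁ (y 0) / warp (y 0)) ^ 2 := by
    rw [Fin.sum_univ_succ]
    simp only [r1, z1, mul_zero, zero_add, Finset.sum_const, Finset.card_univ, Fintype.card_fin,
      nsmul_eq_mul, Nat.cast_add, Nat.cast_ofNat, ne_eq, OfNat.ofNat_ne_zero, not_false_eq_true,
      zero_pow]
  have S2 : ∑ i, (signs h i * warpEntries N δ i (y 0))⁻¹ * (signs h i * warpEntries₂ δ i (y 0))
      = ((q : ℝ) + 2) * ((2 * warp₁ (y 0) ^ 2 + 2 * warp (y 0) * warp₂ (y 0))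
        / warp (y 0) ^ 2) := by
    rw [Fin.sum_univ_succ]
    simp only [r2, z2, mul_zero, zero_add, Finset.sum_const, Finset.card_univ, Fintype.card_fin,
      nsmul_eq_mul, Nat.cast_add, Nat.cast_ofNat]
  rw [hdet, S1, S1', S2, z0, mul_inv, hinv, hN, warpDensity, mul_pow lam, pow_add (warp (y 0))]
  field_simp
  ring

theorem not_continuous_einsteinHilbert_torus (h : r + s = q + 3) (p : ℝ≥0∞) (hp : 1 ≤ p) :
    ¬ Continuous[tau₀ (q + 3) p r s, inferInstance]
      (einsteinHilbert : Config (q + 3) p r s → ℝ) := by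
  let lam : ℕ → ℝ := fun m => 1 / ((m : ℝ) + 1)
  have hl : ∀ m, 0 < lam m := fun m => by positivity
  have hlim : Filter.Tendsto lam Filter.atTop (𝓝 0) := tendsto_one_div_add_atTop_nhds_zero_nat
  have hN : ∀ m, 0 < (lam m ^ (q + 2)) ^ 2 := fun m => by have := hl m; positivity
  have hδ : ∀ m, 0 < lam m ^ 2 := fun m => by have := hl m; positivity
  refine not_continuous_einsteinHilbert (flatConfig p h) (lagrangian_flatConfig p h)
    (torusMfd (q + 3)) (fun m => torusField h p ((lam m ^ (q + 2)) ^ 2) (lam m ^ 2))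
    (fun m => isMetric_diagField h _ _ (torusEntries_pos (hN m) (hδ m)))
    (fun m => diagField_ne_zero h (Nat.succ_pos _) _ _ (torusEntries_pos (hN m) (hδ m))) ?_
    torusMfd_chart_full (signs h 0 * ∫ t in (0 : ℝ)..1, warpDensity q t) ?_ fun m x₀ => ?_
  · refine tendsto_of_comp_eq_mul hp (torusField h p 1 1) _ _
      -- The two coefficients shrink at different rates, so the factor depends on the component.
      -- This is consistent in all charts because the components on the torus do not depend on the
      -- chart.
      (fun m i _ => if i = 0 then (lam m ^ (q + 2)) ^ 2 else lam m ^ 2) (fun i j => ?_)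
      (fun m x₀ i j y _ => ?_) fun _ => rfl
    · split_ifs
      · simpa using (hlim.pow (q + 2)).pow 2
      · simpa using hlim.pow 2
    · refine (comp_torusEntries h _ _ x₀ i j y).trans ?_
      refine Eq.trans ?_ (congrArg _ (comp_torusEntries h 1 1 x₀ i j y).symm)
      unfold warpEntries
      split_ifs <;> ring
  · have := abs_signs h 0
    refine mul_ne_zero (fun h0 => ?_) (integral_warpDensity_pos q).ne'
    simp [h0] at this
  · obtain ⟨a, ha⟩ := torusMfd_target x₀
    rw [integral_congr_ae (lagrangian_torusField h p (hl m) x₀), ha, integral_const_mul,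
      setIntegral_cube a 0 _ (continuous_warpDensity q), integral_warpDensity]

end TorusMetrics

end TopVar

theorem mainTheorem7 (n : ℕ) (hn : 2 ≤ n) (r s : ℕ) (hrs : r + s = n)
    (h11 : ¬ (r = 1 ∧ s = 1)) (p : ℝ≥0∞) (hp : (n : ℝ≥0∞) / 2 < p) :
    ¬ Continuous[TopVar.tau₀ n p r s, inferInstance]
      (TopVar.einsteinHilbert : TopVar.Config n p r s → ℝ) := by
  -- `p > n / 2 ≥ 1` makes Minkowski's inequality available.
  have hp1 : 1 ≤ p := by
    refine le_trans ?_ hp.le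
    rw [ENNReal.le_div_iff_mul_le (by simp) (by simp), one_mul]
    exact_mod_cast hn
  obtain rfl | hn3 := hn.eq_or_lt
  · exact TopVar.not_continuous_einsteinHilbert_two hrs h11 p hp1
  · obtain ⟨q, rfl⟩ := Nat.exists_eq_add_of_le' hn3
    exact TopVar.not_continuous_einsteinHilbert_torus hrs p hp1
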